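/- Let $I=[a,b]\subset\mathbb R$ be a compact interval. A fort of a continuous map $F:I\to I$ is a point of $(a,b)$ that has no neighbourhood on which $F$ is strictly monotone; $F$ is a PM function if it has finitely many forts, $N(F)$ is their number, and the height $H(F)$ is the least integer $i\ge 0$ with $N(F^i)=N(F^{i+1})$ ($\infty$ if there is none), where $F^i$ is the $i$-th iterate. Let $F$ be a PM function with $v=N(F)\ge 3$ forts $c_1<\dots<c_v$, and put $c_0=a$, $c_{v+1}=b$. Suppose that $H(F)=1$ and that, for some $1\le k\le v-1$, $[c_k,c_{k+1}]$ is the characteristic interval of $F$, that is, $F(I)\subseteq[c_k,c_{k+1}]$. Assume: 1. $F$ is strictly increasing on $[c_k,c_{k+1}]$, and the characteristic endpoints condition fails, where that condition says that $F$ takes the value $c_k$ on $I$ only if $F(c_k)=c_k$, and the value $c_{k+1}$ on $I$ only if $F(c_{k+1})=c_{k+1}$. 2. $F$ is reversing-correspondence on $[\alpha,\beta]=[c_k,c_{k+1}]$: with $\mathrm{Fix}$ the set of fixed points of $F$ in $[\alpha,\beta]$, one has $\alpha\in\mathrm{Fix}$ if and only if $\beta\in\mathrm{Fix}$, and there are $\xi\in\mathrm{Fix}$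 and a strictly decreasing map $\omega$ of $\mathrm{Fix}$ onto itself with $\omega(\xi)=\xi$ such that, for all consecutive fixed points $\xi_1<\xi_2\le\xi$, $(F(x)-x)(F(y)-y)<0$ whenever $x\in(\xi_1,\xi_2)$ and $y\in(\omega(\xi_2),\omega(\xi_1))$. 3. One of the following holds: $$c_k=F(c_{k+2})<F(c_k)<F(c_{k+1})=F(c_{k-1})<c_{k+1},$$ $$c_k<F(c_{k+2})<F(c_k)<F(c_{k+1})<F(c_{k-1})<c_{k+1},$$ $$c_k<F(c_{k+2})=F(c_k)<F(c_{k+1})<F(c_{k-1})=c_{k+1}.$$ 4. There are indices $k-1=\ell_0>\ell_1>\dots>\ell_s>\ell_{s+1}=0$ such that, for $0\le j\le s$, $F(c_{\ell_j})=F(c_{k-1})$ if $j\equiv 0,1\pmod 4$ and $F(c_{\ell_j})=F(c_{k+2})$ if $j\equiv 2,3\pmod 4$; $\max_{[c_{\ell_{j+1}},c_{\ell_j}]}F=F(c_{k-1})$ if $j\equiv 0,1,3\pmod 4$; and $\min_{[c_{\ell_{j+1}},c_{\ell_j}]}F=F(c_{k+2})$ if $j\equiv 1,2,3\pmod 4$.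 (If $k=1$, this condition is void.) 5. There are indices $k+2=r_0<r_1<\dots<r_t<r_{t+1}=v+1$ such that, for $0\le j\le t$, $F(c_{r_j})=F(c_{k+2})$ if $j\equiv 0,1\pmod 4$ and $F(c_{r_j})=F(c_{k-1})$ if $j\equiv 2,3\pmod 4$; $\min_{[c_{r_j},c_{r_{j+1}}]}F=F(c_{k+2})$ if $j\equiv 0,1,3\pmod 4$; and $\max_{[c_{r_j},c_{r_{j+1}}]}F=F(c_{k-1})$ if $j\equiv 1,2,3\pmod 4$. (If $k=v-1$, this condition is void.) Then there is a PM function $f:I\to I$ with $f(f(x))=F(x)$ for all $x\in I$ and $H(f)=2$ that is strictly decreasing on $[c_k,c_{k+1}]$. -/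

import Mathlib

open Set

/-- `F` is strictly monotone (increasing or decreasing) in some neighbourhood of `x` in `[a,b]`. -/
def IsMonotonePoint (a b : ℝ) (F : ℝ → ℝ) (x : ℝ) : Prop :=
  ∃ ε > 0, StrictMonoOn F (Ioo (x - ε) (x + ε) ∩ Icc a b) ∨
    StrictAntiOn F (Ioo (x - ε) (x + ε) ∩ Icc a b)

/-- The forts (non-monotone points) of `F` on `[a,b]`: the interior points of `[a,b]` in no
neighbourhood of which `F` is strictly monotone. -/
def forts (a b : ℝ) (F : ℝ → ℝ) : Set ℝ :=
  {x | x ∈ Ioo a b ∧ ¬ IsMonotonePoint a b F x}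

/-- The number `N(F)` of forts. -/
noncomputable def numForts (a b : ℝ) (F : ℝ → ℝ) : ℕ∞ := (forts a b F).encard

/-- `F` restricts to a continuous piecewise monotone self-map of `[a,b]`. -/
structure IsPM (a b : ℝ) (F : ℝ → ℝ) : Prop where
  continuousOn : ContinuousOn F (Icc a b)
  mapsTo : MapsTo F (Icc a b) (Icc a b)
  finite_forts : (forts a b F).Finite

/-- The nonmonotonicity height `H(F)`: the least `i ≥ 0` with `N(F^i) = N(F^(i+1))`, and `∞` if
there is none. -/
noncomputable def height (a b : ℝ) (F : ℝ → ℝ) : ℕ∞ :=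
  ⨅ (i : ℕ) (_ : numForts a b (F^[i]) = numForts a b (F^[i + 1])), (i : ℕ∞)

/-- `a = c 0 < c 1 < ⋯ < c v < c (v+1) = b`, and `c 1, …, c v` are exactly the forts of `F`.
The values of `c` beyond `v + 1` play no role. -/
structure IsFortEnumeration (a b : ℝ) (F : ℝ → ℝ) (v : ℕ) (c : ℕ → ℝ) : Prop where
  left : c 0 = a
  right : c (v + 1) = b
  strictMono : ∀ i ≤ v, c i < c (i + 1)
  forts_eq : forts a b F = c '' Icc 1 v

/-- `[p,q]` is a lap of `F`: its end points are consecutive among `a`, the forts of `F`, and `b`. -/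
structure IsLap (a b : ℝ) (F : ℝ → ℝ) (p q : ℝ) : Prop where
  left_mem : p ∈ insert a (forts a b F)
  right_mem : q ∈ insert b (forts a b F)
  lt : p < q
  no_fort : ∀ x ∈ Ioo p q, x ∉ forts a b F

/-- `[p,q]` is the characteristic interval of `F`: a lap that covers the range of `F`. -/
structure IsCharInterval (a b : ℝ) (F : ℝ → ℝ) (p q : ℝ) : Prop where
  isLap : IsLap a b F p q
  mapsTo : MapsTo F (Icc a b) (Icc p q)

/-- The characteristic endpoints condition `(K⁺₀)` for the characteristic interval `[p,q]`:
`F` reaches the end point `p` (resp. `q`) on `[a,b]` only if `F p = p` (resp. `F q = q`). -/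
def CharEndpointsCondition (a b : ℝ) (F : ℝ → ℝ) (p q : ℝ) : Prop :=
  (∀ x ∈ Icc a b, F x = p → F p = p) ∧ (∀ x ∈ Icc a b, F x = q → F q = q)

/-- The fixed points of `φ` on `[α,β]`. -/
def fixSet (φ : ℝ → ℝ) (α β : ℝ) : Set ℝ := {x | x ∈ Icc α β ∧ φ x = x}

/-- `φ` restricts to a reversing-correspondence function on `[α,β]`. -/
structure IsReversingCorrespondence (φ : ℝ → ℝ) (α β : ℝ) : Prop where
  mapsTo : MapsTo φ (Icc α β) (Icc α β)
  continuousOn : ContinuousOn φ (Icc α β)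
  strictMonoOn : StrictMonoOn φ (Icc α β)
  endpoints : α ∈ fixSet φ α β ↔ β ∈ fixSet φ α β
  correspondence : ∃ ξ ∈ fixSet φ α β, ∃ ω : ℝ → ℝ,
    StrictAntiOn ω (fixSet φ α β) ∧ ω '' fixSet φ α β = fixSet φ α β ∧ ω ξ = ξ ∧
    ∀ ξ₁ ∈ fixSet φ α β, ∀ ξ₂ ∈ fixSet φ α β, ξ₁ < ξ₂ → ξ₂ ≤ ξ →
      (∀ z ∈ Ioo ξ₁ ξ₂, z ∉ fixSet φ α β) →
      ∀ x ∈ Ioo ξ₁ ξ₂, ∀ y ∈ Ioo (ω ξ₂) (ω ξ₁), (φ x - x) * (φ y - y) < 0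

/-- The chain condition to the left of the lap `[c k, c (k+1)]`: indices
`k - 1 = ℓ 0 > ℓ 1 > ⋯ > ℓ m = 0` (so `c (ℓ j)` is a fort for `0 < j < m`) with prescribed values
of `F` at `c (ℓ 0), …, c (ℓ (m-1))` and prescribed maxima and minima of `F` between neighbours.
For `k = 1` the chain is the single index `0` and the condition is void. -/
structure IsLeftChain (F : ℝ → ℝ) (c : ℕ → ℝ) (k m : ℕ) (ℓ : ℕ → ℕ) : Prop where
  start : ℓ 0 = k - 1
  finish : ℓ m = 0
  anti : ∀ j < m, ℓ (j + 1) < ℓ j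
  value : ∀ j < m, F (c (ℓ j)) =
    if j % 4 = 0 ∨ j % 4 = 1 then F (c (k - 1)) else F (c (k + 2))
  max_eq : ∀ j < m, (j % 4 = 0 ∨ j % 4 = 1 ∨ j % 4 = 3) →
    IsGreatest (F '' Icc (c (ℓ (j + 1))) (c (ℓ j))) (F (c (k - 1)))
  min_eq : ∀ j < m, (j % 4 = 1 ∨ j % 4 = 2 ∨ j % 4 = 3) →
    IsLeast (F '' Icc (c (ℓ (j + 1))) (c (ℓ j))) (F (c (k + 2)))

/-- The chain condition to the right of the lap `[c k, c (k+1)]`: indices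
`k + 2 = r 0 < r 1 < ⋯ < r m = v + 1` with prescribed values of `F` at
`c (r 0), …, c (r (m-1))` and prescribed minima and maxima of `F` between neighbours.
For `k + 1 = v` the chain is the single index `v + 1` and the condition is void. -/
structure IsRightChain (F : ℝ → ℝ) (c : ℕ → ℝ) (v k m : ℕ) (r : ℕ → ℕ) : Prop where
  start : r 0 = k + 2
  finish : r m = v + 1
  mono : ∀ j < m, r j < r (j + 1)
  value : ∀ j < m, F (c (r j)) =
    if j % 4 = 0 ∨ j % 4 = 1 then F (c (k + 2)) else F (c (k - 1))
  min_eq : ∀ j < m, (j % 4 = 0 ∨ j % 4 = 1 ∨ j % 4 = 3) →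
    IsLeast (F '' Icc (c (r j)) (c (r (j + 1)))) (F (c (k + 2)))
  max_eq : ∀ j < m, (j % 4 = 1 ∨ j % 4 = 2 ∨ j % 4 = 3) →
    IsGreatest (F '' Icc (c (r j)) (c (r (j + 1)))) (F (c (k - 1)))

/-! Write `p`, `q` for the ends of the characteristic interval `K`, `u`, `w` for the next partition
points outside it, `M = F u` and `m = F w`. A square root `f` is built from a decreasing root `g` of
`F` on `K` with `g p = M` and `g q = m`. On the laps `[u,p]` and `[q,w]` next to `K` it is `g⁻¹ ∘
F`, which is increasing and maps them onto `[p,M]` and `[m,q]`. This gives three inverse branches,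
from `[p,M]`, `[m,M]`, `[m,q]` onto `[u,p]`, `[p,q]`, `[q,w]`. Outside `[u,w]`, `f` is one of these
branches applied to `F`. Neighbouring branches agree only at `M` (common value `p`) and at `m`
(common value `q`), so the branch is changed at points where `F` equals `M` or `m`; the chain
conditions supply such points and keep `F` in the domain of the current branch.

The root `g` (`exists_strictAnti_sqrt`) is found on the whole line, after extending `F` from `K` to
an order isomorphism `A`. Below the central fixed point `ξ` it is a decreasing map commuting with
`A`: it equals `ω` on fixed points, and on each gap between them it is a conjugacy onto the
corresponding gap, where `A` moves points the opposite way; Abel's equation provides it. Above `ξ`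
the root is the inverse of the lower half composed with `A`. The orderings in condition 3 are what
makes the prescribed values at `p` and `q` compatible with the outermost conjugacy.

As for the height (`isPM_and_height_eq_two`), `f³ = g ∘ F` has the forts of `F = f²`, while `f`
passes monotonically through the fort `u` or `w` of `F`. -/

/-- A continuous strictly increasing function on a compact interval extends to an order
isomorphism of the line, by translations outside the interval. -/
theorem exists_orderIso_eqOn {f : ℝ → ℝ} {u w : ℝ} (huw : u ≤ w)
    (hc : ContinuousOn f (Icc u w)) (hm : StrictMonoOn f (Icc u w)) :
    ∃ A : ℝ ≃o ℝ, EqOn A f (Icc u w) ∧ (∀ x ≤ u, A x = f u + (x - u)) ∧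
      ∀ x, w ≤ x → A x = f w + (x - w) := by
  -- The clamp onto `[u,w]`; the extension is `f` at the clamped point plus the displacement `x - pr
  -- x`.
  set pr : ℝ → ℝ := fun x => max u (min w x) with hpr
  have hprm : ∀ x, pr x ∈ Icc u w := fun x =>
    ⟨le_max_left _ _, max_le huw (min_le_left _ _)⟩
  have hprc : Continuous pr := by fun_prop
  have hprmono : ∀ x y, x ≤ y → pr x ≤ pr y := fun x y h => by
    simp only [hpr]; gcongr
  have hprlip : ∀ x y, x ≤ y → x - pr x ≤ y - pr y := fun x y h => by
    simp only [hpr]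
    rcases max_cases u (min w x) with h1 | h1 <;> rcases max_cases u (min w y) with h2 | h2 <;>
    rcases min_cases w x with h3 | h3 <;> rcases min_cases w y with h4 | h4 <;> linarith
  set e : ℝ → ℝ := fun x => f (pr x) + (x - pr x) with he
  have hec : Continuous e :=
    (hc.comp_continuous hprc hprm).add (continuous_id.sub hprc)
  have hem : StrictMono e := fun x y h => by
    simp only [he]
    have h1 := hprmono x y h.le
    have h2 := hprlip x y h.le
    rcases h1.eq_or_lt with h3 | h3
    · rw [h3]; linarith
    · have := hm (hprm x) (hprm y) h3
      linarith
  have hu : u ∈ Icc u w := ⟨le_rfl, huw⟩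
  have hw : w ∈ Icc u w := ⟨huw, le_rfl⟩
  have hes : Function.Surjective e := by
    apply hec.surjective
    · refine Filter.tendsto_atTop_mono (f := fun x => x + (f u - w)) (fun x => ?_)
        (Filter.tendsto_atTop_add_const_right _ _ Filter.tendsto_id)
      have := hm.monotoneOn hu (hprm x) (hprm x).1
      have := (hprm x).2
      simp only [he]; linarith
    · refine Filter.tendsto_atBot_mono (f := fun x => x + (f w - u)) (fun x => ?_)
        (Filter.tendsto_atBot_add_const_right _ _ Filter.tendsto_id)
      have := hm.monotoneOn (hprm x) hw (hprm x).2
      have := (hprm x).1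
      simp only [he]; linarith
  refine ⟨hem.orderIsoOfSurjective e hes, fun x hx => ?_, fun x hx => ?_, fun x hx => ?_⟩
  · have : pr x = x := by simp [hpr, hx.1, hx.2]
    simp [he, this]
  · have : pr x = u := by simp [hpr, hx]
    simp [he, this]
  · have : pr x = w := by simp [hpr, hx, huw]
    simp [he, this]

/-! ### Abel's equation and decreasing conjugacies. -/

section Abel

variable {A : ℝ ≃o ℝ} {S : Set ℝ}

/-- A bounded orbit would have its supremum `l` in `S`, where `A.symm l < l`; an orbit point beyond
`A.symm l` is then sent beyond `l`. -/
theorem exists_lt_pow_apply (hS : S.OrdConnected) (hup : ∀ x ∈ S, x < A x) {x₀ x : ℝ}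
    (h₀ : x₀ ∈ S) (hx : x ∈ S) : ∃ n : ℕ, x < (A ^ n) x₀ := by
  by_contra! h
  have hb : BddAbove (range fun n : ℕ => (A ^ n) x₀) := ⟨x, by rintro _ ⟨n, rfl⟩; exact h n⟩
  set l := ⨆ n : ℕ, (A ^ n) x₀ with hl
  have hl0 : x₀ ≤ l := le_ciSup_of_le hb 0 (by simp)
  have hlS : l ∈ S := hS.out h₀ hx ⟨hl0, ciSup_le h⟩
  have h1 : A.symm l < l := by rw [A.symm_apply_lt]; exact hup l hlS
  obtain ⟨n, hn⟩ := exists_lt_of_lt_ciSup h1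
  rw [A.symm_apply_lt] at hn
  have : (A ^ (n + 1)) x₀ ≤ l := le_ciSup hb (n + 1)
  rw [pow_succ'] at this
  exact absurd hn (not_lt.2 this)

theorem zpow_apply_mem_iff (hinv : ∀ x, A x ∈ S ↔ x ∈ S) (n : ℤ) (x : ℝ) :
    (A ^ n) x ∈ S ↔ x ∈ S := by
  induction n with
  | zero => simp
  | succ n ih => rw [add_comm, zpow_add, zpow_one, ← ih]; exact hinv _
  | pred n ih =>
    rw [← hinv, ← RelIso.mul_apply, ← zpow_one_add, ← ih, add_sub_cancel]

theorem zpow_apply_strictMono {x : ℝ} (hinv : ∀ x, A x ∈ S ↔ x ∈ S)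
    (hup : ∀ x ∈ S, x < A x) (hx : x ∈ S) : StrictMono fun n : ℤ => (A ^ n) x := by
  refine strictMono_int_of_lt_succ fun n => ?_
  rw [add_comm, zpow_add, zpow_one]
  exact hup _ ((zpow_apply_mem_iff hinv n x).2 hx)

theorem exists_zpow_apply_mem_Ico (hS : S.OrdConnected) (hinv : ∀ x, A x ∈ S ↔ x ∈ S)
    (hup : ∀ x ∈ S, x < A x) {x₀ x : ℝ} (h₀ : x₀ ∈ S) (hx : x ∈ S) :
    ∃ n : ℤ, (A ^ n) x₀ ≤ x ∧ x < (A ^ (n + 1)) x₀ := by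
  obtain ⟨N, hN⟩ := exists_lt_pow_apply hS hup h₀ hx
  obtain ⟨N', hN'⟩ := exists_lt_pow_apply hS hup hx h₀
  have hmono := zpow_apply_strictMono hinv hup h₀
  obtain ⟨n, hn, hmax⟩ := Int.exists_greatest_of_bdd (P := fun n : ℤ => (A ^ n) x₀ ≤ x)
    ⟨N, fun z hz => by
      by_contra! hlt
      have := hmono hlt
      simp only [zpow_natCast] at this
      linarith⟩
    ⟨-N', by
      have := (A ^ (-(N' : ℤ))).lt_iff_lt.2 hN'
      rw [← RelIso.mul_apply, ← zpow_natCast, ← zpow_add] at this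
      simpa using this.le⟩
  refine ⟨n, hn, ?_⟩
  by_contra! h
  have := hmax _ h
  omega

/-- An increasing change of variable of `[x₀, y₀]` onto `[0, 1]` with a prescribed interior
value. -/
theorem exists_strictMonoOn_Icc {x₀ y₀ x₁ τ : ℝ} (h : x₀ < y₀) (hx₁ : x₁ ∈ Icc x₀ y₀)
    (hτ : τ ∈ Icc (0 : ℝ) 1) (h0 : x₁ = x₀ ↔ τ = 0) (h1 : x₁ = y₀ ↔ τ = 1) :
    ∃ u : ℝ → ℝ, StrictMonoOn u (Icc x₀ y₀) ∧ u x₀ = 0 ∧ u y₀ = 1 ∧ u x₁ = τ ∧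
      ∀ y ∈ Icc (0 : ℝ) 1, ∃ x ∈ Icc x₀ y₀, u x = y := by
  have hd : 0 < y₀ - x₀ := sub_pos.2 h
  -- The change of variable is a power of the affine one: it fixes 0 and 1, and the exponent is
  -- tuned to the interior value.
  obtain ⟨γ, hγ, hγτ⟩ : ∃ γ : ℝ, 0 < γ ∧ ((x₁ - x₀) / (y₀ - x₀)) ^ γ = τ := by
    by_cases hx0 : x₁ = x₀
    · exact ⟨1, one_pos, by simp [hx0, h0.1 hx0]⟩
    by_cases hx1 : x₁ = y₀
    · exact ⟨1, one_pos, by simp [hx1, h1.1 hx1, hd.ne']⟩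
    have hs0 : 0 < (x₁ - x₀) / (y₀ - x₀) := div_pos (sub_pos.2 (lt_of_le_of_ne hx₁.1 (Ne.symm hx0))) hd
    have hs1 : (x₁ - x₀) / (y₀ - x₀) < 1 := by
      rw [div_lt_one hd]; linarith [lt_of_le_of_ne hx₁.2 hx1]
    have ht0 : 0 < τ := lt_of_le_of_ne hτ.1 fun h => hx0 (h0.2 h.symm)
    have ht1 : τ < 1 := lt_of_le_of_ne hτ.2 fun h => hx1 (h1.2 h)
    have hl := Real.log_neg hs0 hs1
    refine ⟨Real.log τ / Real.log ((x₁ - x₀) / (y₀ - x₀)),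
      div_pos_of_neg_of_neg (Real.log_neg ht0 ht1) hl, ?_⟩
    rw [Real.rpow_def_of_pos hs0, mul_div_cancel₀ _ hl.ne, Real.exp_log ht0]
  refine ⟨fun x => ((x - x₀) / (y₀ - x₀)) ^ γ, fun x hx y hy hxy => ?_, ?_, ?_, hγτ, fun y hy => ?_⟩
  · refine Real.rpow_lt_rpow (div_nonneg (sub_nonneg.2 hx.1) hd.le) ?_ hγ
    gcongr
  · simp [hγ.ne']
  · simp [hd.ne']
  · have hy1 : y ^ γ⁻¹ ≤ 1 := Real.rpow_le_one hy.1 hy.2 (inv_pos.2 hγ).le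
    have hy0 : 0 ≤ y ^ γ⁻¹ := Real.rpow_nonneg hy.1 _
    refine ⟨x₀ + y ^ γ⁻¹ * (y₀ - x₀), ⟨by nlinarith, by nlinarith⟩, ?_⟩
    simp only [add_sub_cancel_left]
    rw [mul_div_cancel_right₀ _ hd.ne', Real.rpow_inv_rpow hy.1 hγ.ne']

/-- An increasing solution of Abel's equation `θ (A x) = θ x + 1` on an invariant interval on
which `A` moves points upwards. -/
theorem exists_abel (hS : S.OrdConnected) (hinv : ∀ x, A x ∈ S ↔ x ∈ S)
    (hup : ∀ x ∈ S, x < A x) {x₀ x₁ τ : ℝ} (h₀ : x₀ ∈ S) (hx₁ : x₁ ∈ Icc x₀ (A x₀))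
    (hτ : τ ∈ Icc (0 : ℝ) 1) (hτ0 : x₁ = x₀ ↔ τ = 0) (hτ1 : x₁ = A x₀ ↔ τ = 1) :
    ∃ θ : ℝ → ℝ, StrictMonoOn θ S ∧ (∀ y, ∃ x ∈ S, θ x = y) ∧ (∀ x ∈ S, θ (A x) = θ x + 1) ∧
      θ x₀ = 0 ∧ θ x₁ = τ := by
  obtain ⟨u, hu, hu0, hu1, huτ, hus⟩ := exists_strictMonoOn_Icc (hup x₀ h₀) hx₁ hτ hτ0 hτ1
  have hmono := zpow_apply_strictMono hinv hup h₀
  have hA0 : A x₀ ∈ S := (hinv _).2 h₀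
  have hIcc : Icc x₀ (A x₀) ⊆ S := hS.out h₀ hA0
  have hmem := zpow_apply_mem_iff hinv
  choose! n hn1 hn2 using fun x (hx : x ∈ S) => exists_zpow_apply_mem_Ico hS hinv hup h₀ hx
  have huniq : ∀ x ∈ S, ∀ k : ℤ, (A ^ k) x₀ ≤ x → x < (A ^ (k + 1)) x₀ → n x = k := by
    intro x hx k hk1 hk2
    have h1 : n x < k + 1 := hmono.lt_iff_lt.1 ((hn1 x hx).trans_lt hk2)
    have h2 : k < n x + 1 := hmono.lt_iff_lt.1 (hk1.trans_lt (hn2 x hx))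
    omega
  have hred : ∀ x ∈ S, x₀ ≤ (A ^ (-n x)) x ∧ (A ^ (-n x)) x < A x₀ := by
    intro x hx
    have h1 := (A ^ (-n x)).le_iff_le.2 (hn1 x hx)
    have h2 := (A ^ (-n x)).lt_iff_lt.2 (hn2 x hx)
    rw [← RelIso.mul_apply, ← zpow_add] at h1 h2
    rw [neg_add_cancel] at h1
    rw [neg_add_cancel_left] at h2
    exact ⟨by simpa using h1, by simpa using h2⟩
  have hu01 : ∀ x ∈ Icc x₀ (A x₀), 0 ≤ u x := fun x hx => by
    rw [← hu0]; exact hu.monotoneOn ⟨le_rfl, (hup x₀ h₀).le⟩ hx hx.1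
  have hu11 : ∀ x ∈ Ico x₀ (A x₀), u x < 1 := fun x hx => by
    rw [← hu1]; exact hu ⟨hx.1, hx.2.le⟩ ⟨(hup x₀ h₀).le, le_rfl⟩ hx.2
  -- `n x` counts the fundamental domains `[Aⁿ x₀, Aⁿ⁺¹ x₀)` up to `x`, and `u` measures the
  -- position of `x` inside its domain.
  set θ : ℝ → ℝ := fun x => n x + u ((A ^ (-n x)) x) with hθ
  have hval : ∀ (k : ℤ), ∀ y ∈ Ico x₀ (A x₀), θ ((A ^ k) y) = k + u y := by
    intro k y hy
    have hyS : (A ^ k) y ∈ S := (hmem _ _).2 (hIcc ⟨hy.1, hy.2.le⟩)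
    have : n ((A ^ k) y) = k := by
      refine huniq _ hyS k ((A ^ k).le_iff_le.2 hy.1) ?_
      rw [zpow_add, zpow_one]; exact (A ^ k).lt_iff_lt.2 hy.2
    simp only [hθ, this]
    rw [← RelIso.mul_apply, ← zpow_add]; simp
  have hrep : ∀ x ∈ S, ∃ k : ℤ, ∃ y ∈ Ico x₀ (A x₀), x = (A ^ k) y := fun x hx =>
    ⟨n x, (A ^ (-n x)) x, hred x hx, by rw [← RelIso.mul_apply, ← zpow_add]; simp⟩
  have h0mem : x₀ ∈ Ico x₀ (A x₀) := ⟨le_rfl, hup x₀ h₀⟩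
  have hθA : ∀ x ∈ S, θ (A x) = θ x + 1 := by
    intro x hx
    obtain ⟨k, y, hy, rfl⟩ := hrep x hx
    have := hval (1 + k) y hy
    rw [zpow_add, zpow_one, RelIso.mul_apply] at this
    rw [this, hval k y hy]; push_cast; ring
  have hθ0 : θ x₀ = 0 := by
    have := hval 0 x₀ h0mem
    simpa [hu0] using this
  refine ⟨θ, fun x hx y hy hxy => ?_, fun y => ?_, hθA, hθ0, ?_⟩
  · have hle : n x ≤ n y := by
      have : n x < n y + 1 := hmono.lt_iff_lt.1 (((hn1 x hx).trans_lt hxy).trans (hn2 y hy))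
      omega
    rcases hle.eq_or_lt with h | h
    · have h1 := hred x hx
      have h2 := hred y hy
      simp only [hθ]
      rw [← h] at h2 ⊢
      have := hu ⟨h1.1, h1.2.le⟩ ⟨h2.1, h2.2.le⟩ ((A ^ (-n x)).lt_iff_lt.2 hxy)
      linarith
    · have h1 := hu11 _ (hred x hx)
      have h2 := hu01 _ ⟨(hred y hy).1, (hred y hy).2.le⟩
      have h3 : (n x : ℝ) + 1 ≤ n y := by exact_mod_cast h
      simp only [hθ]
      linarith
  · obtain ⟨x, hx, hxy⟩ := hus (Int.fract y) ⟨Int.fract_nonneg _, (Int.fract_lt_one _).le⟩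
    have hx' : x ∈ Ico x₀ (A x₀) := by
      refine ⟨hx.1, lt_of_le_of_ne hx.2 ?_⟩
      rintro rfl
      linarith [Int.fract_lt_one y]
    exact ⟨(A ^ ⌊y⌋) x, (hmem _ _).2 (hIcc hx), by
      rw [hval _ _ hx', hxy, Int.floor_add_fract]⟩
  · rcases hx₁.2.eq_or_lt with h | h
    · rw [h, hθA _ h₀, hθ0, hτ1.1 h, zero_add]
    · have := hval 0 x₁ ⟨hx₁.1, h⟩
      simpa [huτ] using this

end Abel

/-- Where `A` moves points upwards on `S` and downwards on `T`, there is a decreasing bijection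
of `S` onto `T` that commutes with `A`. -/
theorem exists_anti_conj {A : ℝ ≃o ℝ} {S T : Set ℝ} (hS : S.OrdConnected) (hT : T.OrdConnected)
    (hSinv : ∀ x, A x ∈ S ↔ x ∈ S) (hTinv : ∀ x, A x ∈ T ↔ x ∈ T)
    (hup : ∀ x ∈ S, x < A x) (hdown : ∀ x ∈ T, A x < x) {x₀ x₁ y₀ y₁ : ℝ} (hx₀ : x₀ ∈ S)
    (hy₀ : y₀ ∈ T) (hx₁ : x₁ ∈ Icc x₀ (A x₀)) (hy₁ : y₁ ∈ Icc (A y₀) y₀)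
    (h0 : x₁ = x₀ ↔ y₁ = y₀) (h1 : x₁ = A x₀ ↔ y₁ = A y₀) :
    ∃ h : ℝ → ℝ, StrictAntiOn h S ∧ h '' S = T ∧ (∀ x ∈ S, h (A x) = A (h x)) ∧
      h x₀ = y₀ ∧ h x₁ = y₁ := by
  -- Only whether `x₁` is an end point matters; 1/2 is an arbitrary interior value.
  obtain ⟨τ, hτ, hτ0, hτ1⟩ : ∃ τ ∈ Icc (0 : ℝ) 1, (x₁ = x₀ ↔ τ = 0) ∧ (x₁ = A x₀ ↔ τ = 1) := by
    have := hup x₀ hx₀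
    by_cases ha : x₁ = x₀
    · exact ⟨0, by simp, by simp [ha], by simp [ha, this.ne]⟩
    by_cases hb : x₁ = A x₀
    · exact ⟨1, by simp, by simp [ha], by simp [hb]⟩
    exact ⟨1 / 2, by norm_num, by simp [ha], by norm_num [hb]⟩
  have hTinv' : ∀ x, A.symm x ∈ T ↔ x ∈ T := fun x => by
    rw [← hTinv (A.symm x), A.apply_symm_apply]
  have hup' : ∀ x ∈ T, x < A.symm x := fun x hx => by
    rw [A.lt_symm_apply]; exact hdown x hx
  obtain ⟨θ, hθm, hθs, hθA, hθ0, hθ1⟩ := exists_abel hS hSinv hup hx₀ hx₁ hτ hτ0 hτ1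
  -- On `T` the map going up is `A.symm`. Its fundamental domain at `y₀` contains `A.symm y₁` rather
  -- than `y₁`, and the value `1 - τ` there makes `η y₁ = -τ`.
  obtain ⟨η, hηm, hηs, hηA, hη0, hη1⟩ := exists_abel (A := A.symm) (x₀ := y₀) (x₁ := A.symm y₁)
    (τ := 1 - τ) hT hTinv' hup' hy₀
    ⟨by rw [A.le_symm_apply]; exact hy₁.1, A.symm.le_iff_le.2 hy₁.2⟩
    ⟨by linarith [hτ.2], by linarith [hτ.1]⟩
    (by rw [A.symm_apply_eq, ← h1, hτ1]; constructor <;> intro h <;> linarith)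
    (by rw [A.symm.injective.eq_iff, ← h0, hτ0]; constructor <;> intro h <;> linarith)
  have hηA' : ∀ y ∈ T, η (A y) = η y - 1 := fun y hy => by
    have := hηA (A y) ((hTinv y).2 hy)
    rw [A.symm_apply_apply] at this
    linarith
  have hy₁T : y₁ ∈ T := hT.out ((hTinv _).2 hy₀) hy₀ hy₁
  have hx₁S : x₁ ∈ S := hS.out hx₀ ((hSinv _).2 hx₀) hx₁
  have hη1' : η y₁ = -τ := by linarith [hηA y₁ hy₁T]
  -- The conjugacy is `η⁻¹ ∘ (-θ)`: in these coordinates `A` is translation by 1 on `S` and by -1 on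
  -- `T`.
  choose h hhT hhη using fun x => hηs (-θ x)
  have huniq : ∀ x, ∀ y ∈ T, η y = -θ x → h x = y := fun x y hy hxy =>
    hηm.injOn (hhT x) hy (by rw [hhη, hxy])
  refine ⟨h, fun x hx y hy hxy => ?_, ?_, fun x hx => ?_, ?_, ?_⟩
  · rw [← hηm.lt_iff_lt (hhT y) (hhT x), hhη, hhη]
    linarith [hθm hx hy hxy]
  · refine Subset.antisymm (by rintro _ ⟨x, -, rfl⟩; exact hhT x) fun y hy => ?_
    obtain ⟨x, hx, hxy⟩ := hθs (-η y)
    exact ⟨x, hx, huniq x y hy (by linarith)⟩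
  · refine huniq _ _ ((hTinv _).2 (hhT x)) ?_
    rw [hηA' _ (hhT x), hhη, hθA x hx]; ring
  · exact huniq _ _ hy₀ (by rw [hη0, hθ0, neg_zero])
  · exact huniq _ _ hy₁T (by rw [hη1', hθ1])

/-! ### Gaps between fixed points and the decreasing square root. -/

/-- The points below `t` that no fixed point of `A` separates from `t`. -/
def lowerGap (A : ℝ → ℝ) (t : ℝ) : Set ℝ := {x | x < t ∧ ∀ z, x ≤ z → z < t → A z ≠ z}

/-- The points above `t` that no fixed point of `A` separates from `t`. -/
def upperGap (A : ℝ → ℝ) (t : ℝ) : Set ℝ := {x | t < x ∧ ∀ z, t < z → z ≤ x → A z ≠ z}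

theorem ordConnected_lowerGap (A : ℝ → ℝ) (t : ℝ) : (lowerGap A t).OrdConnected :=
  ⟨fun _ hx _ hy _ hz => ⟨hz.2.trans_lt hy.1, fun w hw hwt => hx.2 w (hz.1.trans hw) hwt⟩⟩

theorem ordConnected_upperGap (A : ℝ → ℝ) (t : ℝ) : (upperGap A t).OrdConnected :=
  ⟨fun _ hx _ hy _ hz => ⟨hx.1.trans_le hz.1, fun w hw hwt => hy.2 w hw (hwt.trans hz.2)⟩⟩

section Gaps

variable {A : ℝ ≃o ℝ}

/-- `A` preserves order and fixes the points that delimit the gap, so `x` and `A x` lie on the same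
side of each of them. -/
theorem apply_mem_lowerGap_iff {t : ℝ} (ht : A t = t) (x : ℝ) :
    A x ∈ lowerGap A t ↔ x ∈ lowerGap A t := by
  have h1 : A x < t ↔ x < t := by
    conv_lhs => rw [← ht]
    exact A.lt_iff_lt
  have h2 : ∀ z, A z = z → (A x ≤ z ↔ x ≤ z) := fun z hz => by
    conv_lhs => rw [← hz]
    exact A.le_iff_le
  exact and_congr h1 (forall_congr' fun z =>
    ⟨fun h hx hz hAz => h ((h2 z hAz).2 hx) hz hAz, fun h hx hz hAz => h ((h2 z hAz).1 hx) hz hAz⟩)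

theorem apply_mem_upperGap_iff {t : ℝ} (ht : A t = t) (x : ℝ) :
    A x ∈ upperGap A t ↔ x ∈ upperGap A t := by
  have h1 : t < A x ↔ t < x := by
    conv_lhs => rw [← ht]
    exact A.lt_iff_lt
  have h2 : ∀ z, A z = z → (z ≤ A x ↔ z ≤ x) := fun z hz => by
    conv_lhs => rw [← hz]
    exact A.le_iff_le
  exact and_congr h1 (forall_congr' fun z =>
    ⟨fun h hz hx hAz => h hz ((h2 z hAz).2 hx) hAz, fun h hz hx hAz => h hz ((h2 z hAz).1 hx) hAz⟩)

theorem lt_apply_of_no_fixed {S : Set ℝ} (hS : S.OrdConnected) (hfix : ∀ x ∈ S, A x ≠ x)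
    {x₀ : ℝ} (h₀ : x₀ ∈ S) (h : x₀ < A x₀) : ∀ x ∈ S, x < A x := by
  intro x hx
  by_contra! hle
  obtain ⟨z, hz, hzA⟩ := hS.isPreconnected.intermediate_value₂ hx h₀
    A.continuous.continuousOn continuousOn_id hle h.le
  exact hfix z hz hzA

theorem apply_lt_of_no_fixed {S : Set ℝ} (hS : S.OrdConnected) (hfix : ∀ x ∈ S, A x ≠ x)
    {x₀ : ℝ} (h₀ : x₀ ∈ S) (h : A x₀ < x₀) : ∀ x ∈ S, A x < x := by
  intro x hx
  by_contra! hle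
  obtain ⟨z, hz, hzA⟩ := hS.isPreconnected.intermediate_value₂ h₀ hx
    A.continuous.continuousOn continuousOn_id h.le hle
  exact hfix z hz hzA

theorem exists_greatest_fixed {x z : ℝ} (hz : A z = z) (hzx : z ≤ x) :
    ∃ s, A s = s ∧ s ≤ x ∧ ∀ w, A w = w → w ≤ x → w ≤ s := by
  have hcl : IsClosed {w | A w = w ∧ w ≤ x} :=
    (isClosed_eq A.continuous continuous_id).inter isClosed_Iic
  have hbd : BddAbove {w | A w = w ∧ w ≤ x} := ⟨x, fun w hw => hw.2⟩
  have hmem := hcl.csSup_mem ⟨z, hz, hzx⟩ hbd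
  exact ⟨_, hmem.1, hmem.2, fun w h1 h2 => le_csSup hbd ⟨h1, h2⟩⟩

theorem exists_least_fixed {x z : ℝ} (hz : A z = z) (hxz : x ≤ z) :
    ∃ s, A s = s ∧ x ≤ s ∧ ∀ w, A w = w → x ≤ w → s ≤ w := by
  have hcl : IsClosed {w | A w = w ∧ x ≤ w} :=
    (isClosed_eq A.continuous continuous_id).inter isClosed_Ici
  have hbd : BddBelow {w | A w = w ∧ x ≤ w} := ⟨x, fun w hw => hw.2⟩
  have hmem := hcl.csInf_mem ⟨z, hz, hxz⟩ hbd
  exact ⟨_, hmem.1, hmem.2, fun w h1 h2 => csInf_le hbd ⟨h1, h2⟩⟩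

theorem exists_anti_conj_gap {t s x₀ y₀ : ℝ} (ht : A t = t) (hs : A s = s)
    (hx₀ : x₀ ∈ lowerGap A t) (hy₀ : y₀ ∈ upperGap A s) (hsign : (A x₀ - x₀) * (A y₀ - y₀) < 0) :
    ∃ h : ℝ → ℝ, StrictAntiOn h (lowerGap A t) ∧ h '' lowerGap A t = upperGap A s ∧
      ∀ x ∈ lowerGap A t, h (A x) = A (h x) := by
  have hS := ordConnected_lowerGap A t
  have hT := ordConnected_upperGap A s
  have hSf : ∀ x ∈ lowerGap A t, A x ≠ x := fun x hx => hx.2 x le_rfl hx.1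
  have hTf : ∀ x ∈ upperGap A s, A x ≠ x := fun x hx => hx.2 x hx.1 le_rfl
  rcases mul_neg_iff.1 hsign with ⟨h1, h2⟩ | ⟨h1, h2⟩
  · have hup := lt_apply_of_no_fixed hS hSf hx₀ (by linarith)
    have hdown := apply_lt_of_no_fixed hT hTf hy₀ (by linarith)
    obtain ⟨h, ha, hi, hc, -⟩ := exists_anti_conj hS hT (apply_mem_lowerGap_iff ht)
      (apply_mem_upperGap_iff hs) hup hdown hx₀ hy₀ (x₁ := x₀) (y₁ := y₀)
      ⟨le_rfl, (hup _ hx₀).le⟩ ⟨(hdown _ hy₀).le, le_rfl⟩ (by simp)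
      (by simp [(hup _ hx₀).ne, (hdown _ hy₀).ne'])
    exact ⟨h, ha, hi, hc⟩
  -- Here `A` moves the lower gap down, so the conjugacy is made for `A.symm`; commuting with
  -- `A.symm` is commuting with `A`.
  · have hdown := apply_lt_of_no_fixed hS hSf hx₀ (by linarith)
    have hup := lt_apply_of_no_fixed hT hTf hy₀ (by linarith)
    have hup' : ∀ x ∈ lowerGap A t, x < A.symm x := fun x hx => A.lt_symm_apply.2 (hdown x hx)
    have hdown' : ∀ x ∈ upperGap A s, A.symm x < x := fun x hx => A.symm_apply_lt.2 (hup x hx)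
    have hSi : ∀ x, A.symm x ∈ lowerGap A t ↔ x ∈ lowerGap A t := fun x => by
      rw [← apply_mem_lowerGap_iff ht, A.apply_symm_apply]
    obtain ⟨h, ha, hi, hc, -⟩ := exists_anti_conj (A := A.symm) hS hT hSi
      (fun x => by rw [← apply_mem_upperGap_iff hs, A.apply_symm_apply])
      hup' hdown' hx₀ hy₀ (x₁ := x₀) (y₁ := y₀)
      ⟨le_rfl, (hup' _ hx₀).le⟩ ⟨(hdown' _ hy₀).le, le_rfl⟩ (by simp)
      (by simp [(hup' _ hx₀).ne, (hdown' _ hy₀).ne'])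
    refine ⟨h, ha, hi, fun x hx => ?_⟩
    have := hc (A x) ((apply_mem_lowerGap_iff ht x).2 hx)
    rw [A.symm_apply_apply] at this
    rw [this, A.apply_symm_apply]

/-- An increasing homeomorphism of the line with a reversing correspondence of its fixed points
below `ξ` to those above `ξ` has a decreasing square root with prescribed values at a point `p`
below and a point `q` above all fixed points. -/
theorem exists_strictAnti_sqrt {p q m M ξ : ℝ} {ω : ℝ → ℝ}
    (hp : ∀ x ≤ p, x < A x) (hq : ∀ x, q ≤ x → A x < x)
    (hm : m ∈ Icc p (A p)) (hM : M ∈ Icc (A q) q) (h0 : m = p ↔ M = A q) (h1 : m = A p ↔ M = q)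
    (hξ : A ξ = ξ) (hω : StrictAntiOn ω {x | A x = x}) (hωi : ω '' {x | A x = x} = {x | A x = x})
    (hωξ : ω ξ = ξ)
    (hsign : ∀ ξ₁ ξ₂, A ξ₁ = ξ₁ → A ξ₂ = ξ₂ → ξ₁ < ξ₂ → ξ₂ ≤ ξ →
      (∀ z ∈ Ioo ξ₁ ξ₂, A z ≠ z) →
      ∀ x ∈ Ioo ξ₁ ξ₂, ∀ y ∈ Ioo (ω ξ₂) (ω ξ₁), (A x - x) * (A y - y) < 0) :
    ∃ g : ℝ → ℝ, Continuous g ∧ StrictAnti g ∧ (∀ x, g (g x) = A x) ∧ g p = M ∧ g q = m := by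
  have hfp : ∀ x, A x = x → p < x := fun x hx => by
    by_contra! h; exact (hp x h).ne' hx
  have hfq : ∀ x, A x = x → x < q := fun x hx => by
    by_contra! h; exact (hq x h).ne hx
  have hωf : ∀ x, A x = x → A (ω x) = ω x := fun x hx => by
    have : ω x ∈ ω '' {x | A x = x} := ⟨x, hx, rfl⟩
    rwa [hωi] at this
  have hωs : ∀ y, A y = y → ∃ x, A x = x ∧ ω x = y := fun y hy => by
    have : y ∈ ω '' {x | A x = x} := by rw [hωi]; exact hy
    exact this
  have hωlt : ∀ x y, A x = x → A y = y → (ω x < ω y ↔ y < x) := fun x y hx hy => hω.lt_iff_gt hx hy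
  have hωle : ∀ x y, A x = x → A y = y → (ω x ≤ ω y ↔ y ≤ x) := fun x y hx hy => hω.le_iff_ge hx hy
  -- The condition `h m = A q` is forced by the prescribed values: `g m = g (g q) = A q`.
  have hgap : ∀ t, A t = t → t ≤ ξ → ∃ h : ℝ → ℝ, StrictAntiOn h (lowerGap A t) ∧
      h '' lowerGap A t = upperGap A (ω t) ∧ (∀ x ∈ lowerGap A t, h (A x) = A (h x)) ∧
      (p ∈ lowerGap A t → h p = M ∧ h m = A q) := by
    intro t ht htξ
    by_cases hex : ∃ z, A z = z ∧ z < t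
    · obtain ⟨z, hz, hzt⟩ := hex
      have hpS : p ∉ lowerGap A t := fun h => h.2 z (hfp z hz).le hzt hz
      by_cases hcons : ∃ s, A s = s ∧ s < t ∧ ∀ w ∈ Ioo s t, A w ≠ w
      · obtain ⟨s, hs, hst, hw⟩ := hcons
        have hωst := (hωlt t s ht hs).2 hst
        have hx : (s + t) / 2 ∈ Ioo s t := ⟨by linarith, by linarith⟩
        have hy : (ω t + ω s) / 2 ∈ Ioo (ω t) (ω s) := ⟨by linarith, by linarith⟩
        obtain ⟨h, ha, hi, hc⟩ := exists_anti_conj_gap (x₀ := (s + t) / 2)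
          (y₀ := (ω t + ω s) / 2) ht (hωf t ht)
          ⟨hx.2, fun w h1 h2 => hw w ⟨hx.1.trans_le h1, h2⟩⟩
          ⟨hy.1, fun w h1 h2 hAw => by
            obtain ⟨w', hw', rfl⟩ := hωs w hAw
            exact hw w' ⟨(hωlt _ _ hw' hs).1 (h2.trans_lt hy.2), (hωlt _ _ ht hw').1 h1⟩ hw'⟩
          (hsign s t hs ht hst htξ hw _ hx _ hy)
        exact ⟨h, ha, hi, hc, fun h => absurd h hpS⟩
      -- Fixed points accumulate at `t` from below, hence at `ω t` from above, and both gaps are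
      -- empty.
      · push Not at hcons
        have hS : lowerGap A t = ∅ := by
          refine eq_empty_of_forall_notMem fun x hx => ?_
          have hzx : z ≤ x := by
            by_contra! h; exact hx.2 z h.le hzt hz
          obtain ⟨s, hs, hsx, hmax⟩ := exists_greatest_fixed hz hzx
          obtain ⟨w, hw, hAw⟩ := hcons s hs (hsx.trans_lt hx.1)
          rcases le_total w x with h | h
          · exact absurd (hmax w hAw h) (not_le.2 hw.1)
          · exact hx.2 w h hw.2 hAw
        have hT : upperGap A (ω t) = ∅ := by
          refine eq_empty_of_forall_notMem fun y hy => ?_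
          have hyz : y ≤ ω z := by
            by_contra! h; exact hy.2 _ ((hωlt _ _ ht hz).2 hzt) h.le (hωf z hz)
          obtain ⟨r, hr, hyr, hmin⟩ := exists_least_fixed (hωf z hz) hyz
          obtain ⟨s, hs, rfl⟩ := hωs r hr
          obtain ⟨w, hw, hAw⟩ := hcons s hs ((hωlt _ _ ht hs).1 (hy.1.trans_le hyr))
          rcases le_total (ω w) y with h | h
          · exact hy.2 _ ((hωlt _ _ ht hAw).2 hw.2) h (hωf w hAw)
          · exact absurd ((hωle _ _ hs hAw).1 (hmin _ (hωf w hAw) h)) (not_le.2 hw.1)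
        exact ⟨id, by simp [hS, StrictAntiOn], by simp [hS, hT], by simp [hS], by simp [hS]⟩
    -- Now `t` is the least fixed point, `ω t` the greatest, and the gaps are half-lines. The
    -- fundamental domain `[p, A p]`, which contains `m`, is matched with `[A M, M]`, which contains
    -- `A q`.
    · push Not at hex
      have hωt := hωf t ht
      have hpS : p ∈ lowerGap A t :=
        ⟨hfp t ht, fun z _ h2 h3 => absurd (hex z h3) (not_le.2 h2)⟩
      have htop : ∀ z, ω t < z → A z ≠ z := fun z h1 h3 => by
        obtain ⟨w, hw, rfl⟩ := hωs z h3
        exact absurd (hex w hw) (not_le.2 ((hωlt _ _ ht hw).1 h1))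
      have hMT : M ∈ upperGap A (ω t) := by
        refine ⟨lt_of_lt_of_le ?_ hM.1, fun z h1 _ => htop z h1⟩
        rw [← hωt]; exact A.lt_iff_lt.2 (hfq _ hωt)
      have hqT : q ∈ upperGap A (ω t) := ⟨hfq _ hωt, fun z h1 _ => htop z h1⟩
      have hS := ordConnected_lowerGap A t
      have hT := ordConnected_upperGap A (ω t)
      obtain ⟨h, ha, hi, hc, hpv, hmv⟩ := exists_anti_conj (y₁ := A q) hS hT
        (apply_mem_lowerGap_iff ht) (apply_mem_upperGap_iff hωt)
        (lt_apply_of_no_fixed hS (fun x hx => hx.2 x le_rfl hx.1) hpS (hp p le_rfl))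
        (apply_lt_of_no_fixed hT (fun x hx => hx.2 x hx.1 le_rfl) hqT (hq q le_rfl))
        hpS hMT hm ⟨A.le_iff_le.2 hM.2, hM.1⟩ (h0.trans eq_comm)
        (h1.trans (eq_comm.trans A.injective.eq_iff.symm))
      exact ⟨h, ha, hi, hc, fun _ => ⟨hpv, hmv⟩⟩
  choose! h ha hi hc hpm using hgap
  -- The least fixed point `r x ≥ x` labels the gap that contains a non-fixed `x`.
  choose! r hr hxr hrmin using fun x (hx : x ≤ ξ) => exists_least_fixed hξ hx
  have hrξ : ∀ x ≤ ξ, r x ≤ ξ := fun x hx => hrmin x hx ξ hξ hx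
  have hrgap : ∀ x ≤ ξ, A x ≠ x → x ∈ lowerGap A (r x) := fun x hx hAx =>
    ⟨lt_of_le_of_ne (hxr x hx) fun h => hAx (by rw [h]; exact hr x hx),
      fun z h1 h2 h3 => absurd (hrmin x hx z h3 h1) (not_le.2 h2)⟩
  set g : ℝ → ℝ := open Classical in fun x => if A x = x then ω x else h (r x) x with hg
  have hgfix : ∀ x, A x = x → g x = ω x := fun x hx => by simp [hg, hx]
  have hggap : ∀ t, A t = t → t ≤ ξ → ∀ x ∈ lowerGap A t, g x = h t x := fun t ht htξ x hx => by
    have hxξ : x ≤ ξ := hx.1.le.trans htξ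
    have : r x = t := by
      refine le_antisymm (hrmin x hxξ t ht hx.1.le) ?_
      by_contra! hlt
      exact hx.2 _ (hxr x hxξ) hlt (hr x hxξ)
    simp [hg, hx.2 x le_rfl hx.1, this]
  have hgmem : ∀ t, A t = t → t ≤ ξ → ∀ x ∈ lowerGap A t, g x ∈ upperGap A (ω t) :=
    fun t ht htξ x hx => by
      rw [hggap t ht htξ x hx, ← hi t ht htξ]; exact mem_image_of_mem _ hx
  -- The image of a gap is a gap, so `g y` cannot cross the fixed point `ω z`.
  have hlow : ∀ z y, A z = z → z ≤ y → y ≤ ξ → A y ≠ y → g y < ω z := by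
    intro z y hz hzy hy hAy
    have h2 := hgmem _ (hr y hy) (hrξ y hy) y (hrgap y hy hAy)
    have h3 : ω (r y) < ω z := (hωlt _ _ (hr y hy) hz).2
      ((lt_of_le_of_ne hzy fun h => hAy (h ▸ hz)).trans_le (hxr y hy))
    by_contra! hle
    exact h2.2 _ h3 hle (hωf z hz)
  have hganti : StrictAntiOn g (Iic ξ) := by
    intro x hx y hy hxy
    have hx : x ≤ ξ := hx
    have hy : y ≤ ξ := hy
    by_cases hAx : A x = x <;> by_cases hAy : A y = y
    · rw [hgfix x hAx, hgfix y hAy]; exact hω hAx hAy hxy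
    · rw [hgfix x hAx]; exact hlow x y hAx hxy.le hy hAy
    · have h1 := (hgmem _ (hr x hx) (hrξ x hx) x (hrgap x hx hAx)).1
      rw [hgfix y hAy]
      exact ((hωle _ _ hAy (hr x hx)).2 (hrmin x hx y hAy hxy.le)).trans_lt h1
    · have h1 := hgmem _ (hr x hx) (hrξ x hx) x (hrgap x hx hAx)
      rcases le_or_gt (r x) y with hle | hlt
      · exact (hlow _ y (hr x hx) hle hy hAy).trans h1.1
      · have hyg : y ∈ lowerGap A (r x) :=
          ⟨hlt, fun z h3 h4 => (hrgap x hx hAx).2 z (hxy.le.trans h3) h4⟩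
        rw [hggap _ (hr x hx) (hrξ x hx) x (hrgap x hx hAx),
          hggap _ (hr x hx) (hrξ x hx) y hyg]
        exact ha _ (hr x hx) (hrξ x hx) (hrgap x hx hAx) hyg hxy
  have hgξ : g ξ = ξ := by rw [hgfix ξ hξ, hωξ]
  have hge : ∀ x ≤ ξ, ξ ≤ g x := fun x hx => by
    have := hganti.antitoneOn hx (le_refl ξ) hx
    rwa [hgξ] at this
  have hgsurj : ∀ y, ξ ≤ y → ∃ x ≤ ξ, g x = y := by
    intro y hy
    have hback : ∀ t, A t = t → ξ ≤ ω t → t ≤ ξ := fun t ht h => by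
      rw [← hωξ] at h; exact (hωle _ _ hξ ht).1 h
    obtain ⟨s, hs, hsy, hmax⟩ := exists_greatest_fixed hξ hy
    obtain ⟨t, ht, rfl⟩ := hωs s hs
    have htξ : t ≤ ξ := hback t ht (hmax ξ hξ hy)
    rcases hsy.eq_or_lt with heq | hlt
    · exact ⟨t, htξ, by rw [hgfix t ht, heq]⟩
    · have hyT : y ∈ upperGap A (ω t) :=
        ⟨hlt, fun z h1 h2 h3 => absurd (hmax z h3 h2) (not_le.2 h1)⟩
      rw [← hi t ht htξ] at hyT
      obtain ⟨x, hx, rfl⟩ := hyT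
      exact ⟨x, hx.1.le.trans htξ, hggap t ht htξ x hx⟩
  have hgA : ∀ x ≤ ξ, g (A x) = A (g x) := by
    intro x hx
    by_cases hAx : A x = x
    · rw [hAx, hgfix x hAx, hωf x hAx]
    · have hxg := hrgap x hx hAx
      rw [hggap _ (hr x hx) (hrξ x hx) x hxg, hggap _ (hr x hx) (hrξ x hx) _
        ((apply_mem_lowerGap_iff (hr x hx) x).2 hxg)]
      exact hc _ (hr x hx) (hrξ x hx) x hxg
  have hpξ : p < ξ := hfp ξ hξ
  have hpf : A p ≠ p := (hp p le_rfl).ne'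
  have hgp : g p = M := by
    rw [hggap _ (hr p hpξ.le) (hrξ p hpξ.le) p (hrgap p hpξ.le hpf)]
    exact (hpm _ (hr p hpξ.le) (hrξ p hpξ.le) (hrgap p hpξ.le hpf)).1
  have hApξ : A p < ξ := by rw [← hξ]; exact A.lt_iff_lt.2 hpξ
  have hgm : g m = A q := by
    have hmg : m ∈ lowerGap A (r p) := (ordConnected_lowerGap A (r p)).out
      (hrgap p hpξ.le hpf)
      ((apply_mem_lowerGap_iff (hr p hpξ.le) p).2 (hrgap p hpξ.le hpf)) hm
    rw [hggap _ (hr p hpξ.le) (hrξ p hpξ.le) m hmg]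
    exact (hpm _ (hr p hpξ.le) (hrξ p hpξ.le) (hrgap p hpξ.le hpf)).2
  -- `k` is the inverse of `g`, from above `ξ` back to below it.
  choose! k hkξ hgk using hgsurj
  have hkg : ∀ x ≤ ξ, k (g x) = x := fun x hx =>
    hganti.injOn (hkξ _ (hge x hx)) hx (hgk _ (hge x hx))
  have hAξ : ∀ x, ξ ≤ x → ξ ≤ A x := fun x hx => by
    rw [← hξ]; exact A.le_iff_le.2 hx
  -- Each half is mapped to the other. From above, `g (k (A x)) = A x`; from below, `k (A (g x)) = k
  -- (g (A x)) = A x`.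
  set f : ℝ → ℝ := fun x => if x ≤ ξ then g x else k (A x) with hf
  have hfle : ∀ x ≤ ξ, f x = g x := fun x hx => by simp [hf, hx]
  have hfgt : ∀ x, ξ < x → f x = k (A x) := fun x hx => by simp [hf, hx]
  have hfge : ∀ x, ξ ≤ x → f x = k (A x) := fun x hx => by
    rcases hx.eq_or_lt with rfl | h
    · have := hkg ξ le_rfl
      rw [hgξ] at this
      rw [hfle _ le_rfl, hξ, hgξ, this]
    · exact hfgt x h
  have hkanti : StrictAntiOn k (Ici ξ) := fun x hx y hy hxy => by
    rw [← hganti.lt_iff_gt (hkξ x hx) (hkξ y hy), hgk x hx, hgk y hy]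
    exact hxy
  have hfanti : StrictAnti f := by
    have h1 : StrictAntiOn f (Iic ξ) := hganti.congr fun x hx => (hfle x hx).symm
    have h2 : StrictAntiOn f (Ici ξ) := fun x hx y hy hxy => by
      rw [hfge x hx, hfge y hy]
      exact hkanti (hAξ x hx) (hAξ y hy) (A.lt_iff_lt.2 hxy)
    exact h1.Iic_union_Ici h2
  have hff : ∀ x, f (f x) = A x := by
    intro x
    rcases le_total x ξ with hx | hx
    · have hAx : A x ≤ ξ := by rw [← hξ]; exact A.le_iff_le.2 hx
      rw [hfle x hx, hfge _ (hge x hx), ← hgA x hx, hkg _ hAx]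
    · rw [hfge x hx, hfle _ (hkξ _ (hAξ x hx)), hgk _ (hAξ x hx)]
  have hfsurj : Function.Surjective f := fun y => ⟨f (A.symm y), by rw [hff, A.apply_symm_apply]⟩
  refine ⟨f, hfanti.antitone.dual_right.continuous_of_surjective hfsurj, hfanti, hff, ?_, ?_⟩
  · rw [hfle p hpξ.le, hgp]
  -- Both `f (f q)` and `f m` equal `A q`.
  · apply hfanti.injective
    rw [hff, hfle m (hm.2.trans hApξ.le), hgm]

end Gaps

/-! ### Forts and the height of a square root. -/

theorem forts_congr {a b : ℝ} {f F : ℝ → ℝ} (h : EqOn f F (Icc a b)) :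
    forts a b f = forts a b F := by
  have key : ∀ {f F : ℝ → ℝ}, EqOn f F (Icc a b) → forts a b f ⊆ forts a b F :=
    fun h x hx => ⟨hx.1, fun ⟨ε, hε, hmono⟩ => hx.2 ⟨ε, hε, hmono.imp
      (fun hm => hm.congr fun y hy => (h hy.2).symm)
      (fun hm => hm.congr fun y hy => (h hy.2).symm)⟩⟩
  exact (key h).antisymm (key h.symm)

theorem forts_strictAnti_comp {a b : ℝ} {g : ℝ → ℝ} (hg : StrictAnti g) (F : ℝ → ℝ) :
    forts a b (g ∘ F) = forts a b F := by
  have key : ∀ x, IsMonotonePoint a b (g ∘ F) x ↔ IsMonotonePoint a b F x := fun x => by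
    refine exists_congr fun ε => and_congr_right fun _ => ?_
    rw [or_comm]
    simp only [StrictMonoOn, StrictAntiOn, Function.comp_apply, hg.lt_iff_gt]
  ext x
  simp only [forts, mem_ofPred_eq, key]

theorem isMonotonePoint_of_injOn {a b u w x : ℝ} {f : ℝ → ℝ} (hf : ContinuousOn f (Icc a b))
    (hsub : Icc u w ⊆ Icc a b) (hinj : InjOn f (Icc u w)) (hx : x ∈ Ioo u w) :
    IsMonotonePoint a b f x := by
  have hss : Ioo (x - min (x - u) (w - x)) (x + min (x - u) (w - x)) ∩ Icc a b ⊆ Icc u w := by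
    rintro y ⟨⟨h1, h2⟩, -⟩
    have := min_le_left (x - u) (w - x)
    have := min_le_right (x - u) (w - x)
    exact ⟨by linarith, by linarith⟩
  refine ⟨min (x - u) (w - x), lt_min (sub_pos.2 hx.1) (sub_pos.2 hx.2), ?_⟩
  exact ((hf.mono hsub).strictMonoOn_of_injOn_Icc' (hx.1.trans hx.2).le hinj).imp
    (fun h => h.mono hss) (fun h => h.mono hss)

/-- A value common to both sides must be `f d`, so injectivity on the two sides gives injectivity
across `d`, and continuity turns this into strict monotonicity. -/
theorem isMonotonePoint_of_le_of_ge {a b u w d : ℝ} {f : ℝ → ℝ} (hf : ContinuousOn f (Icc a b))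
    (hsub : Icc u w ⊆ Icc a b) (hd : d ∈ Ioo u w) (h1 : InjOn f (Icc u d))
    (h2 : InjOn f (Icc d w)) (hle : ∀ x ∈ Icc u d, f x ≤ f d) (hge : ∀ x ∈ Icc d w, f d ≤ f x) :
    IsMonotonePoint a b f d := by
  have key : ∀ x ∈ Icc u d, ∀ y ∈ Icc d w, f x = f y → x = y := fun x hx y hy hxy => by
    have hxd : f x = f d := le_antisymm (hle x hx) (hxy ▸ hge y hy)
    rw [h1 hx ⟨hd.1.le, le_rfl⟩ hxd, h2 hy ⟨le_rfl, hd.2.le⟩ (hxy ▸ hxd)]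
  refine isMonotonePoint_of_injOn hf hsub (fun x hx y hy hxy => ?_) hd
  rcases le_total x d with hxd | hxd <;> rcases le_total y d with hyd | hyd
  · exact h1 ⟨hx.1, hxd⟩ ⟨hy.1, hyd⟩ hxy
  · exact key x ⟨hx.1, hxd⟩ y ⟨hyd, hy.2⟩ hxy
  · exact (key y ⟨hy.1, hyd⟩ x ⟨hxd, hx.2⟩ hxy.symm).symm
  · exact h2 ⟨hxd, hx.2⟩ ⟨hyd, hy.2⟩ hxy

theorem IsMonotonePoint.not_isLocalExtr {a b x : ℝ} {f : ℝ → ℝ} (hx : x ∈ Ioo a b)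
    (h : IsMonotonePoint a b f x) : ¬ IsLocalExtr f x := by
  intro hext
  obtain ⟨ε, hε, hmono⟩ := h
  have hnhds : Ioo (x - ε) (x + ε) ∩ Icc a b ∈ nhds x :=
    Filter.inter_mem (Ioo_mem_nhds (by linarith) (by linarith)) (Icc_mem_nhds hx.1 hx.2)
  have hxm := mem_of_mem_nhds hnhds
  have aux : ∀ P : ℝ → Prop, (∀ᶠ y in nhds x, P y) →
      (∃ y ∈ Ioo (x - ε) (x + ε) ∩ Icc a b, y < x ∧ P y) ∧
      ∃ y ∈ Ioo (x - ε) (x + ε) ∩ Icc a b, x < y ∧ P y := fun P hP => by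
    obtain ⟨δ, hδ, hball⟩ := Metric.mem_nhds_iff.1 (Filter.inter_mem hnhds hP)
    have h1 := hball (show x - δ / 2 ∈ Metric.ball x δ by
      rw [Real.ball_eq_Ioo]; constructor <;> linarith)
    have h2 := hball (show x + δ / 2 ∈ Metric.ball x δ by
      rw [Real.ball_eq_Ioo]; constructor <;> linarith)
    exact ⟨⟨_, h1.1, by linarith, h1.2⟩, ⟨_, h2.1, by linarith, h2.2⟩⟩
  rcases hext with hmin | hmax
  · obtain ⟨⟨y, hy, hyx, hfy⟩, ⟨z, hz, hxz, hfz⟩⟩ := aux _ hmin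
    rcases hmono with hm | hm
    · exact absurd (hm hy hxm hyx) (not_lt.2 hfy)
    · exact absurd (hm hxm hz hxz) (not_lt.2 hfz)
  · obtain ⟨⟨y, hy, hyx, hfy⟩, ⟨z, hz, hxz, hfz⟩⟩ := aux _ hmax
    rcases hmono with hm | hm
    · exact absurd (hm hxm hz hxz) (not_lt.2 hfz)
    · exact absurd (hm hy hxm hyx) (not_lt.2 hfy)

/-- By Rolle's argument two equal values enclose a local extremum, which is a fort. -/
theorem injOn_of_no_forts {a b u w : ℝ} {f : ℝ → ℝ} (hf : ContinuousOn f (Icc a b))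
    (hsub : Icc u w ⊆ Icc a b) (hno : ∀ x ∈ Ioo u w, x ∉ forts a b f) : InjOn f (Icc u w) := by
  have key : ∀ x ∈ Icc u w, ∀ y ∈ Icc u w, x < y → f x ≠ f y := fun x hx y hy hxy he => by
    have hss : Icc x y ⊆ Icc u w := Icc_subset_Icc hx.1 hy.2
    obtain ⟨z, hz, hext⟩ := exists_isLocalExtr_Ioo hxy (hf.mono (hss.trans hsub)) he
    have hzab : z ∈ Ioo a b :=
      ⟨(hsub hx).1.trans_lt hz.1, hz.2.trans_le (hsub hy).2⟩
    have hzf := hno z ⟨hx.1.trans_lt hz.1, hz.2.trans_le hy.2⟩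
    have : IsMonotonePoint a b f z := by
      by_contra h; exact hzf ⟨hzab, h⟩
    exact this.not_isLocalExtr hzab hext
  intro x hx y hy he
  rcases lt_trichotomy x y with h | h | h
  · exact absurd he (key x hx y hy h)
  · exact h
  · exact absurd he.symm (key y hy x hx h)

/-- Where `F = f ∘ f` is injective so is `f`, and a continuous injective function on an interval is
strictly monotone. -/
theorem forts_subset_of_sqrt {a b : ℝ} {f F : ℝ → ℝ} (hf : ContinuousOn f (Icc a b))
    (hff : ∀ x ∈ Icc a b, f (f x) = F x) : forts a b f ⊆ forts a b F := by
  rintro x ⟨hx, hxf⟩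
  refine ⟨hx, fun ⟨ε, hε, hmono⟩ => hxf ?_⟩
  have hsub : Icc (max a (x - ε / 2)) (min b (x + ε / 2)) ⊆ Icc a b :=
    Icc_subset_Icc (le_max_left _ _) (min_le_left _ _)
  have hinj : InjOn F (Ioo (x - ε) (x + ε) ∩ Icc a b) :=
    hmono.elim (fun h => h.injOn) (fun h => h.injOn)
  refine isMonotonePoint_of_injOn hf hsub (fun y hy z hz hyz => ?_)
    ⟨max_lt hx.1 (by linarith), lt_min hx.2 (by linarith)⟩
  have hmem : ∀ y ∈ Icc (max a (x - ε / 2)) (min b (x + ε / 2)),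
      y ∈ Ioo (x - ε) (x + ε) ∩ Icc a b := fun y hy => by
    have h1 := (le_max_right _ _).trans hy.1
    have h2 := hy.2.trans (min_le_right _ _)
    exact ⟨⟨by linarith, by linarith⟩, hsub hy⟩
  exact hinj (hmem y hy) (hmem z hz) (by rw [← hff y (hsub hy), ← hff z (hsub hz), hyz])

/-- A continuous square root that agrees with a decreasing function on an interval covering the
range and that lacks one of the forts has height two. -/
theorem isPM_and_height_eq_two {a b p q d : ℝ} {f F g : ℝ → ℝ} (hF : IsPM a b F)
    (hf : ContinuousOn f (Icc a b)) (hmaps : MapsTo f (Icc a b) (Icc a b))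
    (hff : ∀ x ∈ Icc a b, f (f x) = F x) (hg : StrictAnti g)
    (hFK : MapsTo F (Icc a b) (Icc p q)) (hfg : EqOn f g (Icc p q))
    (hd : d ∈ forts a b F) (hdf : IsMonotonePoint a b f d) :
    IsPM a b f ∧ height a b f = 2 := by
  have hsub := forts_subset_of_sqrt hf hff
  have h0 : numForts a b (f^[0]) = 0 := by
    rw [numForts, encard_eq_zero]
    exact eq_empty_of_forall_notMem fun x hx =>
      hx.2 ⟨1, one_pos, Or.inl (strictMonoOn_id)⟩
  -- Without forts `f` would be injective on `[a,b]`, and so would `F`, contrary to its fort `d`.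
  have h1 : numForts a b (f^[1]) ≠ 0 := by
    rw [numForts, Ne, encard_eq_zero, Function.iterate_one]
    intro hempty
    have hinj := injOn_of_no_forts hf Subset.rfl (fun x _ => by rw [hempty]; exact notMem_empty x)
    have hFinj : InjOn F (Icc a b) := fun x hx y hy hxy => by
      rw [← hff x hx, ← hff y hy] at hxy
      exact hinj hx hy (hinj (hmaps hx) (hmaps hy) hxy)
    exact hd.2 (isMonotonePoint_of_injOn hF.continuousOn Subset.rfl hFinj hd.1)
  have h2 : numForts a b (f^[2]) = numForts a b F :=
    congrArg encard (forts_congr fun x hx => hff x hx)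
  have h3 : numForts a b (f^[3]) = numForts a b F := by
    rw [numForts, numForts, ← forts_strictAnti_comp hg F]
    refine congrArg encard (forts_congr fun x hx => ?_)
    have : f (f (f x)) = g (F x) := by rw [hff x hx, hfg (hFK hx)]
    exact this
  have h12 : numForts a b (f^[1]) ≠ numForts a b F := by
    have hss : forts a b f ⊂ forts a b F := ⟨hsub, fun h => (h hd).2 hdf⟩
    exact ((hF.finite_forts.subset hsub).encard_lt_encard hss).ne
  refine ⟨⟨hf, hmaps, hF.finite_forts.subset hsub⟩, le_antisymm ?_ ?_⟩
  · exact iInf₂_le (2 : ℕ) (h2.trans h3.symm)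
  · refine le_iInf₂ fun i hi => ?_
    rcases i with _ | _ | i
    · exact absurd (h0.symm.trans hi).symm h1
    · exact absurd (hi.trans h2) h12
    · exact_mod_cast Nat.le_add_left 2 i

/-! ### Gluing branches along a chain. -/

theorem exists_glue {u v w : ℝ} {f₁ f₂ : ℝ → ℝ} (huv : u ≤ v) (hvw : v ≤ w)
    (h₁ : ContinuousOn f₁ (Icc u v)) (h₂ : ContinuousOn f₂ (Icc v w)) (h : f₁ v = f₂ v) :
    ∃ f : ℝ → ℝ, ContinuousOn f (Icc u w) ∧ EqOn f f₁ (Icc u v) ∧ EqOn f f₂ (Icc v w) := by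
  set f : ℝ → ℝ := fun x => if x ≤ v then f₁ x else f₂ x with hf
  have e₁ : EqOn f f₁ (Icc u v) := fun x hx => if_pos hx.2
  have e₂ : EqOn f f₂ (Icc v w) := fun x hx => by
    rcases hx.1.eq_or_lt with rfl | hlt
    · simp [hf, h]
    · exact if_neg (not_le.2 hlt)
  refine ⟨f, ?_, e₁, e₂⟩
  rw [← Icc_union_Icc_eq_Icc huv hvw]
  exact (h₁.congr e₁).union_of_isClosed (h₂.congr e₂) isClosed_Icc isClosed_Icc

theorem exists_glue_seq {d : ℕ → ℝ} {e : ℕ → ℝ → ℝ} (N : ℕ) (hd : ∀ j < N, d j ≤ d (j + 1))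
    (he : ∀ j < N, ContinuousOn (e j) (Icc (d j) (d (j + 1))))
    (hmatch : ∀ j, j + 1 < N → e j (d (j + 1)) = e (j + 1) (d (j + 1))) :
    ∃ f : ℝ → ℝ, ContinuousOn f (Icc (d 0) (d N)) ∧ f (d 0) = e 0 (d 0) ∧
      (∀ j < N, EqOn f (e j) (Icc (d j) (d (j + 1)))) ∧
      ∀ x ∈ Icc (d 0) (d N), x = d 0 ∨ ∃ j < N, x ∈ Icc (d j) (d (j + 1)) := by
  have hmono : ∀ i j, i ≤ j → j ≤ N → d i ≤ d j := fun i j hij => by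
    induction hij with
    | refl => exact fun _ => le_rfl
    | step _ ih => exact fun h => (ih (by omega)).trans (hd _ (by omega))
  induction N with
  | zero =>
    refine ⟨e 0, by simp, rfl, fun j hj => absurd hj (by omega), fun x hx => Or.inl ?_⟩
    exact le_antisymm hx.2 hx.1
  | succ N ih =>
    obtain ⟨f, hf, hf0, hfe, hcov⟩ := ih (fun j hj => hd j (by omega))
      (fun j hj => he j (by omega)) (fun j hj => hmatch j (by omega))
      (fun i j hij hj => hmono i j hij (by omega))
    have h0N : d 0 ≤ d N := hmono 0 N (by omega) (by omega)
    have hNN : d N ≤ d (N + 1) := hd N (by omega)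
    have hval : f (d N) = e N (d N) := by
      rcases N with _ | n
      · exact hf0
      · rw [hfe n (by omega) ⟨hd n (by omega), le_rfl⟩, hmatch n (by omega)]
    obtain ⟨f', hf', he1, he2⟩ := exists_glue h0N hNN hf (he N (by omega)) hval
    refine ⟨f', hf', by rw [he1 ⟨le_rfl, h0N⟩, hf0], fun j hj => ?_, fun x hx => ?_⟩
    · rcases (Nat.lt_succ_iff_lt_or_eq.1 hj) with h | rfl
      · intro x hx
        rw [he1 ⟨(hmono 0 j (by omega) (by omega)).trans hx.1,
          hx.2.trans (hmono _ _ (by omega) (by omega))⟩, hfe j h hx]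
      · exact he2
    · rcases le_total x (d N) with h | h
      · exact (hcov x ⟨hx.1, h⟩).imp id fun ⟨j, hj, hxj⟩ => ⟨j, by omega, hxj⟩
      · exact Or.inr ⟨N, by omega, h, hx.2⟩

/-- The branch of the inverse used on the `j`-th link of a chain. -/
def chainBranch (S₀ S₁ S₂ : ℝ → ℝ) (j : ℕ) : ℝ → ℝ :=
  if j % 4 = 0 then S₀ else if j % 4 = 2 then S₂ else S₁

theorem chainBranch_zero (S₀ S₁ S₂ : ℝ → ℝ) {j : ℕ} (h : j % 4 = 0) :
    chainBranch S₀ S₁ S₂ j = S₀ := if_pos h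

theorem chainBranch_two (S₀ S₁ S₂ : ℝ → ℝ) {j : ℕ} (h : j % 4 = 2) :
    chainBranch S₀ S₁ S₂ j = S₂ := by simp [chainBranch, h]

theorem chainBranch_odd (S₀ S₁ S₂ : ℝ → ℝ) {j : ℕ} (h : j % 4 = 1 ∨ j % 4 = 3) :
    chainBranch S₀ S₁ S₂ j = S₁ := by rcases h with h | h <;> simp [chainBranch, h]

theorem exists_chain {F S₀ S₁ S₂ : ℝ → ℝ} {d : ℕ → ℝ} {V₀ V₂ : ℝ} {N : ℕ}
    (hd : ∀ j < N, d j ≤ d (j + 1)) (hF : ContinuousOn F (Icc (d 0) (d N)))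
    (h₀ : Continuous S₀) (h₁ : Continuous S₁) (h₂ : Continuous S₂) (e₀ : S₀ V₀ = S₁ V₀)
    (e₂ : S₁ V₂ = S₂ V₂)
    (hval : ∀ j < N, F (d j) = if j % 4 = 0 ∨ j % 4 = 1 then V₀ else V₂) :
    ∃ f : ℝ → ℝ, ContinuousOn f (Icc (d 0) (d N)) ∧ f (d 0) = S₀ (F (d 0)) ∧
      (∀ j < N, ∀ x ∈ Icc (d j) (d (j + 1)), f x = chainBranch S₀ S₁ S₂ j (F x)) ∧
      ∀ x ∈ Icc (d 0) (d N), x = d 0 ∨ ∃ j < N, x ∈ Icc (d j) (d (j + 1)) := by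
  have hmono : ∀ i j, i ≤ j → j ≤ N → d i ≤ d j := fun i j hij => by
    induction hij with
    | refl => exact fun _ => le_rfl
    | step _ ih => exact fun h => (ih (by omega)).trans (hd _ (by omega))
  have hcont : ∀ j, Continuous (chainBranch S₀ S₁ S₂ j) := fun j => by
    unfold chainBranch; split_ifs <;> assumption
  obtain ⟨f, hf, hf0, hfe, hcov⟩ := exists_glue_seq
    (e := fun j x => chainBranch S₀ S₁ S₂ j (F x)) N hd
    (fun j hj => (hcont j).comp_continuousOn (hF.mono (Icc_subset_Icc
      (hmono 0 j (by omega) (by omega)) (hmono _ N (by omega) le_rfl))))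
    -- The branches run `S₀, S₁, S₂, S₁` periodically. The changes between `S₀` and `S₁` fall on
    -- nodes with residue 0 or 1, where `F` is `V₀`, and those between `S₁` and `S₂` on residues 2
    -- or 3, where it is `V₂`.
    (fun j hj => by
      simp only [hval _ hj, chainBranch]
      have : j % 4 = 0 ∨ j % 4 = 1 ∨ j % 4 = 2 ∨ j % 4 = 3 := by omega
      rcases this with h | h | h | h <;> simp [Nat.add_mod, h, e₀, e₂])
  exact ⟨f, hf, hf0, hfe, hcov⟩

/-- The mirror image of `exists_chain` under `x ↦ -x`, for chains that run to the left. -/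
theorem exists_chain_anti {F S₀ S₁ S₂ : ℝ → ℝ} {d : ℕ → ℝ} {V₀ V₂ : ℝ} {N : ℕ}
    (hd : ∀ j < N, d (j + 1) ≤ d j) (hF : ContinuousOn F (Icc (d N) (d 0)))
    (h₀ : Continuous S₀) (h₁ : Continuous S₁) (h₂ : Continuous S₂) (e₀ : S₀ V₀ = S₁ V₀)
    (e₂ : S₁ V₂ = S₂ V₂)
    (hval : ∀ j < N, F (d j) = if j % 4 = 0 ∨ j % 4 = 1 then V₀ else V₂) :
    ∃ f : ℝ → ℝ, ContinuousOn f (Icc (d N) (d 0)) ∧ f (d 0) = S₀ (F (d 0)) ∧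
      (∀ j < N, ∀ x ∈ Icc (d (j + 1)) (d j), f x = chainBranch S₀ S₁ S₂ j (F x)) ∧
      ∀ x ∈ Icc (d N) (d 0), x = d 0 ∨ ∃ j < N, x ∈ Icc (d (j + 1)) (d j) := by
  have hneg : ∀ {s t x : ℝ}, x ∈ Icc s t → -x ∈ Icc (-t) (-s) := fun hx =>
    ⟨neg_le_neg hx.2, neg_le_neg hx.1⟩
  obtain ⟨f, hf, hf0, hfe, hcov⟩ := exists_chain (F := fun x => F (-x)) (d := fun j => -d j)
    (N := N) (fun j hj => neg_le_neg (hd j hj))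
    (hF.comp continuous_neg.continuousOn fun x hx => by simpa using hneg hx) h₀ h₁ h₂ e₀ e₂
    (by simpa using hval)
  refine ⟨fun x => f (-x), hf.comp continuous_neg.continuousOn fun x hx => hneg hx,
    by simpa using hf0, fun j hj x hx => ?_, fun x hx => ?_⟩
  · simpa using hfe j hj (-x) (hneg hx)
  · refine (hcov (-x) (hneg hx)).imp neg_inj.1 fun ⟨j, hj, hxj⟩ => ⟨j, hj, ?_⟩
    simpa using hneg hxj

/-! ### Laps between enumerated forts. -/

theorem IsFortEnumeration.lt {a b : ℝ} {F : ℝ → ℝ} {v : ℕ} {c : ℕ → ℝ}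
    (hc : IsFortEnumeration a b F v c) {i j : ℕ} (hij : i < j) (hj : j ≤ v + 1) : c i < c j := by
  induction hij with
  | refl => exact hc.strictMono i (by omega)
  | step h ih => exact (ih (by omega)).trans (hc.strictMono _ (by omega))

theorem IsFortEnumeration.le {a b : ℝ} {F : ℝ → ℝ} {v : ℕ} {c : ℕ → ℝ}
    (hc : IsFortEnumeration a b F v c) {i j : ℕ} (hij : i ≤ j) (hj : j ≤ v + 1) : c i ≤ c j :=
  hij.eq_or_lt.elim (fun h => h ▸ le_rfl) fun h => (hc.lt h hj).le

theorem IsFortEnumeration.mem_Icc {a b : ℝ} {F : ℝ → ℝ} {v : ℕ} {c : ℕ → ℝ}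
    (hc : IsFortEnumeration a b F v c) {i : ℕ} (hi : i ≤ v + 1) : c i ∈ Icc a b :=
  ⟨hc.left ▸ hc.le (Nat.zero_le i) hi, hc.right ▸ hc.le hi le_rfl⟩

theorem IsFortEnumeration.mem_forts {a b : ℝ} {F : ℝ → ℝ} {v : ℕ} {c : ℕ → ℝ}
    (hc : IsFortEnumeration a b F v c) {i : ℕ} (h1 : 1 ≤ i) (hi : i ≤ v) : c i ∈ forts a b F := by
  rw [hc.forts_eq]; exact mem_image_of_mem c ⟨h1, hi⟩

theorem IsFortEnumeration.injOn_lap {a b : ℝ} {F : ℝ → ℝ} {v : ℕ} {c : ℕ → ℝ}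
    (hc : IsFortEnumeration a b F v c) (hF : ContinuousOn F (Icc a b)) {i : ℕ} (hi : i ≤ v) :
    InjOn F (Icc (c i) (c (i + 1))) := by
  refine injOn_of_no_forts hF
    (Icc_subset_Icc (hc.mem_Icc (by omega)).1 (hc.mem_Icc (by omega)).2) fun x hx hxf => ?_
  rw [hc.forts_eq] at hxf
  obtain ⟨j, hj, rfl⟩ := hxf
  have hjv : j ≤ v := hj.2
  rcases le_or_gt j i with h | h
  · exact absurd hx.1 (not_lt.2 (hc.le h (by omega)))
  · exact absurd hx.2 (not_lt.2 (hc.le h (by omega)))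

/-- A lap next to a fort at which an increasing lap ends on the other side is decreasing. -/
theorem strictAntiOn_left_of_fort {a b u d w : ℝ} {F : ℝ → ℝ} (hF : ContinuousOn F (Icc a b))
    (hsub : Icc u w ⊆ Icc a b) (hud : u < d) (hdw : d < w) (hinj : InjOn F (Icc u d))
    (hm : StrictMonoOn F (Icc d w)) (hd : d ∈ forts a b F) : StrictAntiOn F (Icc u d) := by
  have hF' : ContinuousOn F (Icc u d) :=
    hF.mono ((Icc_subset_Icc_right hdw.le).trans hsub)
  refine (hF'.strictMonoOn_of_injOn_Icc' hud.le hinj).resolve_left fun h => hd.2 ?_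
  exact isMonotonePoint_of_le_of_ge hF hsub ⟨hud, hdw⟩ hinj hm.injOn
    (fun x hx => h.monotoneOn hx ⟨hud.le, le_rfl⟩ hx.2)
    (fun x hx => hm.monotoneOn ⟨le_rfl, hdw.le⟩ hx hx.1)

theorem strictAntiOn_right_of_fort {a b u d w : ℝ} {F : ℝ → ℝ} (hF : ContinuousOn F (Icc a b))
    (hsub : Icc u w ⊆ Icc a b) (hud : u < d) (hdw : d < w) (hinj : InjOn F (Icc d w))
    (hm : StrictMonoOn F (Icc u d)) (hd : d ∈ forts a b F) : StrictAntiOn F (Icc d w) := by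
  have hF' : ContinuousOn F (Icc d w) :=
    hF.mono ((Icc_subset_Icc_left hud.le).trans hsub)
  refine (hF'.strictMonoOn_of_injOn_Icc' hdw.le hinj).resolve_left fun h => hd.2 ?_
  exact isMonotonePoint_of_le_of_ge hF hsub ⟨hud, hdw⟩ hm.injOn hinj
    (fun x hx => hm.monotoneOn hx ⟨hud.le, le_rfl⟩ hx.2)
    (fun x hx => h.monotoneOn ⟨le_rfl, hdw.le⟩ hx hx.1)

/-! ### Construction of the square root. -/

theorem theorem2p4 (a b : ℝ) (F : ℝ → ℝ) (v : ℕ) (c : ℕ → ℝ) (k : ℕ)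
    (hF : IsPM a b F)
    (hc : IsFortEnumeration a b F v c)
    (hv : 2 < v)
    (hH : height a b F = 1)
    (hk : 1 ≤ k) (hkv : k + 1 ≤ v)
    (hK : IsCharInterval a b F (c k) (c (k + 1)))
    (hKplus : StrictMonoOn F (Icc (c k) (c (k + 1))))
    (hK0 : ¬ CharEndpointsCondition a b F (c k) (c (k + 1)))
    (hrev : IsReversingCorrespondence F (c k) (c (k + 1)))
    (hord :
      (c k = F (c (k + 2)) ∧ F (c (k + 2)) < F (c k) ∧ F (c k) < F (c (k + 1)) ∧
        F (c (k + 1)) = F (c (k - 1)) ∧ F (c (k - 1)) < c (k + 1)) ∨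
      (c k < F (c (k + 2)) ∧ F (c (k + 2)) < F (c k) ∧ F (c k) < F (c (k + 1)) ∧
        F (c (k + 1)) < F (c (k - 1)) ∧ F (c (k - 1)) < c (k + 1)) ∨
      (c k < F (c (k + 2)) ∧ F (c (k + 2)) = F (c k) ∧ F (c k) < F (c (k + 1)) ∧
        F (c (k + 1)) < F (c (k - 1)) ∧ F (c (k - 1)) = c (k + 1)))
    (hleft : ∃ (m : ℕ) (l : ℕ → ℕ), IsLeftChain F c k m l)
    (hright : ∃ (m : ℕ) (r : ℕ → ℕ), IsRightChain F c v k m r) :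
    ∃ f : ℝ → ℝ, IsPM a b f ∧ (∀ x ∈ Icc a b, f (f x) = F x) ∧ height a b f = 2 ∧
      StrictAntiOn f (Icc (c k) (c (k + 1))) := by
  have hFc := hF.continuousOn
  set u := c (k - 1) with hu
  set p := c k with hp
  set q := c (k + 1) with hq
  set w := c (k + 2) with hw
  set m := F w with hm
  set M := F u with hM
  have hup : u < p := hc.lt (by omega) (by omega)
  have hpq : p < q := hc.lt (by omega) (by omega)
  have hqw : q < w := hc.lt (by omega) (by omega)
  have hau : a ≤ u := (hc.mem_Icc (by omega)).1
  have hwb : w ≤ b := (hc.mem_Icc (by omega)).2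
  have hsub : Icc u w ⊆ Icc a b := Icc_subset_Icc hau hwb
  have hFK := hK.mapsTo
  have hpf : p ∈ forts a b F := hc.mem_forts hk (by omega)
  have hqf : q ∈ forts a b F := hc.mem_forts (by omega) hkv
  have hinjL : InjOn F (Icc u p) := by
    have := hc.injOn_lap hFc (i := k - 1) (by omega)
    rwa [Nat.sub_add_cancel hk] at this
  have hantiL : StrictAntiOn F (Icc u p) := strictAntiOn_left_of_fort hFc
    ((Icc_subset_Icc_right hqw.le).trans hsub) hup hpq hinjL hKplus hpf
  have hantiR : StrictAntiOn F (Icc q w) := strictAntiOn_right_of_fort hFc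
    ((Icc_subset_Icc_left hup.le).trans hsub) hpq hqw (hc.injOn_lap hFc (i := k + 1) (by omega))
    hKplus hqf
  obtain ⟨A, hAF, hAp, hAq⟩ := exists_orderIso_eqOn hpq.le
    (hFc.mono ((Icc_subset_Icc hup.le hqw.le).trans hsub)) hKplus
  have hApv : A p = F p := hAF ⟨le_rfl, hpq.le⟩
  have hAqv : A q = F q := hAF ⟨hpq.le, le_rfl⟩
  -- All that is needed from the three orderings: the compatibility of `g p = M` and `g q = m`
  -- required by `exists_strictAnti_sqrt`.
  have hbounds : p < F p ∧ F q < q ∧ p ≤ m ∧ m ≤ F p ∧ F q ≤ M ∧ M ≤ q ∧ (m = p ↔ M = F q) ∧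
      (m = F p ↔ M = q) := by
    rcases hord with ⟨h1, h2, h3, h4, h5⟩ | ⟨h1, h2, h3, h4, h5⟩ | ⟨h1, h2, h3, h4, h5⟩ <;>
    refine ⟨by linarith, by linarith, by linarith, by linarith, by linarith, by linarith, ?_, ?_⟩ <;>
    constructor <;> intro h <;> linarith
  obtain ⟨hpF, hqF, hpm, hmp, hqM, hMq, hm0, hm1⟩ := hbounds
  have hFpq : F p < F q := hKplus ⟨le_rfl, hpq.le⟩ ⟨hpq.le, le_rfl⟩ hpq
  -- Outside `K` the extension is a translation towards `K`, so it adds no fixed points.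
  have hAlow : ∀ x ≤ p, x < A x := fun x hx => by rw [hAp x hx]; linarith
  have hAhigh : ∀ x, q ≤ x → A x < x := fun x hx => by rw [hAq x hx]; linarith
  have hfix : {x | A x = x} = fixSet F p q := by
    ext x
    constructor
    · intro hx
      have hx : A x = x := hx
      have hxK : x ∈ Icc p q := by
        constructor <;> by_contra! h
        · exact (hAlow x h.le).ne' hx
        · exact (hAhigh x h.le).ne hx
      exact ⟨hxK, by rw [← hAF hxK, hx]⟩
    · rintro ⟨hxK, hx⟩
      exact (hAF hxK).trans hx
  have hmemfix : ∀ {x}, A x = x ↔ x ∈ fixSet F p q := fun {x} => by rw [← hfix]; rfl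
  obtain ⟨g, hgc, hganti, hgg, hgp, hgq⟩ : ∃ g : ℝ → ℝ, Continuous g ∧ StrictAnti g ∧
      (∀ x, g (g x) = A x) ∧ g p = M ∧ g q = m := by
    obtain ⟨ξ, hξ, ω, hω, hωi, hωξ, hsign⟩ := hrev.correspondence
    refine exists_strictAnti_sqrt (ξ := ξ) (ω := ω) hAlow hAhigh ⟨hpm, by rwa [hApv]⟩
      ⟨by rwa [hAqv], hMq⟩ (by rwa [hAqv]) (by rwa [hApv]) (hmemfix.2 hξ) (by rwa [hfix])
      (by rwa [hfix]) hωξ fun ξ₁ ξ₂ h1 h2 h12 h2ξ hcons x hx y hy => ?_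
    rw [hmemfix] at h1 h2
    have hω1 : ω ξ₁ ∈ fixSet F p q := hωi ▸ mem_image_of_mem ω h1
    have hω2 : ω ξ₂ ∈ fixSet F p q := hωi ▸ mem_image_of_mem ω h2
    rw [hAF ⟨h1.1.1.trans hx.1.le, hx.2.le.trans h2.1.2⟩,
      hAF ⟨hω2.1.1.trans hy.1.le, hy.2.le.trans hω1.1.2⟩]
    exact hsign ξ₁ h1 ξ₂ h2 h12 h2ξ (fun z hz => fun hzf => hcons z hz (hmemfix.2 hzf)) x hx y hy
  have hgA : ∀ x, g (A x) = A (g x) := fun x => by rw [← hgg, ← hgg]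
  -- The inverse of `g`, since `g ∘ g = A`.
  set gi : ℝ → ℝ := fun x => A.symm (g x) with hgi
  have hgic : Continuous gi := A.symm.continuous.comp hgc
  have hgianti : StrictAnti gi := fun x y h => A.symm.lt_iff_lt.2 (hganti h)
  have hgig : ∀ x, gi (g x) = x := fun x => by simp [hgi, hgg]
  have hggi : ∀ x, g (gi x) = x := fun x => by
    apply A.injective
    rw [← hgA]
    simp [hgi, hgg]
  have hgiM : gi M = p := by rw [← hgp, hgig]
  have hgim : gi m = q := by rw [← hgq, hgig]
  have hgiFp : gi (F p) = M := by rw [← hApv, ← hgg, hgig, hgp]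
  have hgiFq : gi (F q) = m := by rw [← hAqv, ← hgg, hgig, hgq]
  have hgiF : ∀ {s t}, StrictAntiOn F (Icc s t) → StrictMonoOn (fun x => gi (F x)) (Icc s t) :=
    fun h x hx y hy hxy => hgianti (h hx hy hxy)
  -- Extending `g⁻¹ ∘ F` from a side lap to the line makes its inverse a globally continuous branch.
  obtain ⟨EL, hEL, -⟩ := exists_orderIso_eqOn hup.le (hgic.comp_continuousOn
    (hFc.mono ((Icc_subset_Icc_right (hpq.trans hqw).le).trans hsub))) (hgiF hantiL)
  obtain ⟨ER, hER, -⟩ := exists_orderIso_eqOn hqw.le (hgic.comp_continuousOn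
    (hFc.mono ((Icc_subset_Icc_left (hup.trans hpq).le).trans hsub))) (hgiF hantiR)
  have hELu : EL u = p := (hEL ⟨le_rfl, hup.le⟩).trans hgiM
  have hELp : EL p = M := (hEL ⟨hup.le, le_rfl⟩).trans hgiFp
  have hERq : ER q = m := (hER ⟨le_rfl, hqw.le⟩).trans hgiFq
  have hERw : ER w = q := (hER ⟨hqw.le, le_rfl⟩).trans hgim
  have hLM : EL.symm M = p := by rw [← hELp, EL.symm_apply_apply]
  have hRm : ER.symm m = q := by rw [← hERq, ER.symm_apply_apply]
  have hSL : ∀ y ∈ Icc p M, EL.symm y ∈ Icc u p := fun y hy =>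
    ⟨by rw [EL.le_symm_apply, hELu]; exact hy.1, by rw [EL.symm_apply_le, hELp]; exact hy.2⟩
  have hSR : ∀ y ∈ Icc m q, ER.symm y ∈ Icc q w := fun y hy =>
    ⟨by rw [ER.le_symm_apply, hERq]; exact hy.1, by rw [ER.symm_apply_le, hERw]; exact hy.2⟩
  have hSC : ∀ y ∈ Icc m M, gi y ∈ Icc p q := fun y hy =>
    ⟨by rw [← hgiM]; exact hgianti.antitone hy.2, by rw [← hgim]; exact hgianti.antitone hy.1⟩
  obtain ⟨nl, l, hl⟩ := hleft
  obtain ⟨nr, r, hr⟩ := hright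
  have hlmono : ∀ i j, i ≤ j → j ≤ nl → l j ≤ l i := fun i j hij => by
    induction hij with
    | refl => exact fun _ => le_rfl
    | step _ ih => exact fun h => (hl.anti _ (by omega)).le.trans (ih (by omega))
  have hrmono : ∀ i j, i ≤ j → j ≤ nr → r i ≤ r j := fun i j hij => by
    induction hij with
    | refl => exact fun _ => le_rfl
    | step _ ih => exact fun h => (ih (by omega)).trans (hr.mono _ (by omega)).le
  have hlle : ∀ j ≤ nl, l j ≤ k - 1 := fun j hj => hl.start ▸ hlmono 0 j (by omega) hj
  have hrle : ∀ j ≤ nr, r j ≤ v + 1 := fun j hj => hr.finish ▸ hrmono j nr hj le_rfl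
  have hl0 : c (l 0) = u := by rw [hl.start]
  have hlN : c (l nl) = a := by rw [hl.finish, hc.left]
  have hr0 : c (r 0) = w := by rw [hr.start]
  have hrN : c (r nr) = b := by rw [hr.finish, hc.right]
  obtain ⟨fl, hflc, hflu, hfle, hflcov⟩ := exists_chain_anti (F := F) (S₀ := EL.symm) (S₁ := gi)
    (S₂ := ER.symm) (d := fun j => c (l j)) (V₀ := M) (V₂ := m) (N := nl)
    (fun j hj => hc.le (hl.anti j hj).le ((hlle j hj.le).trans (by omega)))
    (by simp only [hl0, hlN]; exact hFc.mono (Icc_subset_Icc_right (by linarith)))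
    EL.symm.continuous hgic ER.symm.continuous (hLM.trans hgiM.symm) (hgim.trans hRm.symm) hl.value
  obtain ⟨fr, hfrc, hfrw, hfre, hfrcov⟩ := exists_chain (F := F) (S₀ := ER.symm) (S₁ := gi)
    (S₂ := EL.symm) (d := fun j => c (r j)) (V₀ := m) (V₂ := M) (N := nr)
    (fun j hj => hc.le (hr.mono j hj).le (hrle _ hj))
    (by simp only [hr0, hrN]; exact hFc.mono (Icc_subset_Icc_left (by linarith)))
    ER.symm.continuous hgic EL.symm.continuous (hRm.trans hgim.symm) (hgiM.trans hLM.symm) hr.value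
  simp only [hl0, hlN, ← hM] at hflc hflu hflcov
  simp only [hr0, hrN, ← hm] at hfrc hfrw hfrcov
  rw [hLM] at hflu
  rw [hRm] at hfrw
  -- `lifts y z` says that one of the three central pieces of `f` sends `y` to `z`. For `y = f x`
  -- and `z = F x` it yields both that `f` stays in `[u,w]` and that `f (f x) = F x`.
  let lifts : ℝ → ℝ → Prop := fun y z =>
    (y ∈ Icc u p ∧ EL y = z) ∨ (y ∈ Icc p q ∧ g y = z) ∨ (y ∈ Icc q w ∧ ER y = z)
  have hliftL : ∀ y ∈ Icc p M, lifts (EL.symm y) y := fun y hy =>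
    Or.inl ⟨hSL y hy, EL.apply_symm_apply y⟩
  have hliftC : ∀ y ∈ Icc m M, lifts (gi y) y := fun y hy =>
    Or.inr (Or.inl ⟨hSC y hy, hggi y⟩)
  have hliftR : ∀ y ∈ Icc m q, lifts (ER.symm y) y := fun y hy =>
    Or.inr (Or.inr ⟨hSR y hy, ER.apply_symm_apply y⟩)
  have hlK : ∀ j < nl, ∀ x ∈ Icc (c (l (j + 1))) (c (l j)), F x ∈ Icc p q := fun j hj x hx =>
    hFK ⟨(hc.mem_Icc ((hlle (j + 1) hj).trans (by omega))).1.trans hx.1,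
      hx.2.trans (hc.mem_Icc ((hlle j hj.le).trans (by omega))).2⟩
  have hrK : ∀ j < nr, ∀ x ∈ Icc (c (r j)) (c (r (j + 1))), F x ∈ Icc p q := fun j hj x hx =>
    hFK ⟨(hc.mem_Icc (hrle j hj.le)).1.trans hx.1, hx.2.trans (hc.mem_Icc (hrle _ hj)).2⟩
  have hcases : ∀ j : ℕ, j % 4 = 0 ∨ j % 4 = 2 ∨ (j % 4 = 1 ∨ j % 4 = 3) := fun j => by omega
  have hliftl : ∀ x ∈ Icc a u, lifts (fl x) (F x) := by
    intro x hx
    rcases hflcov x hx with rfl | ⟨j, hj, hxj⟩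
    · rw [hflu, ← hLM]; exact hliftL M ⟨by linarith, le_rfl⟩
    · rw [hfle j hj x hxj]
      have hxK := hlK j hj x hxj
      have hmax : (j % 4 = 0 ∨ j % 4 = 1 ∨ j % 4 = 3) → F x ≤ M := fun h =>
        (hl.max_eq j hj h).2 (mem_image_of_mem F hxj)
      have hmin : (j % 4 = 1 ∨ j % 4 = 2 ∨ j % 4 = 3) → m ≤ F x := fun h =>
        (hl.min_eq j hj h).2 (mem_image_of_mem F hxj)
      rcases hcases j with h | h | h
      · rw [chainBranch_zero _ _ _ h]; exact hliftL _ ⟨hxK.1, hmax (by omega)⟩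
      · rw [chainBranch_two _ _ _ h]; exact hliftR _ ⟨hmin (by omega), hxK.2⟩
      · rw [chainBranch_odd _ _ _ h]; exact hliftC _ ⟨hmin (by omega), hmax (by omega)⟩
  have hliftr : ∀ x ∈ Icc w b, lifts (fr x) (F x) := by
    intro x hx
    rcases hfrcov x hx with rfl | ⟨j, hj, hxj⟩
    · rw [hfrw, ← hRm]; exact hliftR m ⟨le_rfl, by linarith⟩
    · rw [hfre j hj x hxj]
      have hxK := hrK j hj x hxj
      have hmin : (j % 4 = 0 ∨ j % 4 = 1 ∨ j % 4 = 3) → m ≤ F x := fun h =>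
        (hr.min_eq j hj h).2 (mem_image_of_mem F hxj)
      have hmax : (j % 4 = 1 ∨ j % 4 = 2 ∨ j % 4 = 3) → F x ≤ M := fun h =>
        (hr.max_eq j hj h).2 (mem_image_of_mem F hxj)
      rcases hcases j with h | h | h
      · rw [chainBranch_zero _ _ _ h]; exact hliftR _ ⟨hmin (by omega), hxK.2⟩
      · rw [chainBranch_two _ _ _ h]; exact hliftL _ ⟨hxK.1, hmax (by omega)⟩
      · rw [chainBranch_odd _ _ _ h]; exact hliftC _ ⟨hmin (by omega), hmax (by omega)⟩
  -- The values at the joints `u`, `p`, `q`, `w` are `p`, `M`, `m`, `q`.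
  obtain ⟨f₁, hf₁c, hf₁l, hf₁e⟩ := exists_glue hau hup.le hflc EL.continuous.continuousOn
    (hflu.trans hELu.symm)
  obtain ⟨f₂, hf₂c, hf₂l, hf₂e⟩ := exists_glue (hau.trans hup.le) hpq.le hf₁c hgc.continuousOn
    ((hf₁e ⟨hup.le, le_rfl⟩).trans (hELp.trans hgp.symm))
  obtain ⟨f₃, hf₃c, hf₃l, hf₃e⟩ := exists_glue (hau.trans (hup.trans hpq).le) hqw.le hf₂c
    ER.continuous.continuousOn ((hf₂e ⟨hpq.le, le_rfl⟩).trans (hgq.trans hERq.symm))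
  obtain ⟨f, hfc, hfl, hfr⟩ := exists_glue (hau.trans (hup.trans (hpq.trans hqw)).le) hwb hf₃c
    hfrc ((hf₃e ⟨hqw.le, le_rfl⟩).trans (hERw.trans hfrw.symm))
  have hfER : EqOn f ER (Icc q w) := fun x hx => by
    rw [hfl ⟨by linarith [hx.1], hx.2⟩, hf₃e hx]
  have hfg : EqOn f g (Icc p q) := fun x hx => by
    rw [hfl ⟨by linarith [hx.1], by linarith [hx.2]⟩, hf₃l ⟨by linarith [hx.1], hx.2⟩, hf₂e hx]
  have hfEL : EqOn f EL (Icc u p) := fun x hx => by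
    rw [hfl ⟨by linarith [hx.1], by linarith [hx.2]⟩,
      hf₃l ⟨by linarith [hx.1], by linarith [hx.2]⟩, hf₂l ⟨by linarith [hx.1], hx.2⟩, hf₁e hx]
  have hffl : EqOn f fl (Icc a u) := fun x hx => by
    rw [hfl ⟨hx.1, by linarith [hx.2]⟩, hf₃l ⟨hx.1, by linarith [hx.2]⟩,
      hf₂l ⟨hx.1, by linarith [hx.2]⟩, hf₁l hx]
  have hlift : ∀ x ∈ Icc a b, lifts (f x) (F x) := by
    intro x hx
    rcases le_total x u with h1 | h1
    · rw [hffl ⟨hx.1, h1⟩]; exact hliftl x ⟨hx.1, h1⟩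
    rcases le_total x p with h2 | h2
    · rw [hfEL ⟨h1, h2⟩, hEL ⟨h1, h2⟩]
      exact hliftC _ ⟨hmp.trans (hantiL.antitoneOn ⟨h1, h2⟩ ⟨hup.le, le_rfl⟩ h2),
        hantiL.antitoneOn ⟨le_rfl, hup.le⟩ ⟨h1, h2⟩ h1⟩
    rcases le_total x q with h3 | h3
    · rw [hfg ⟨h2, h3⟩]
      refine Or.inr (Or.inl ⟨⟨hpm.trans ?_, le_trans ?_ hMq⟩, ?_⟩)
      · rw [← hgq]; exact hganti.antitone h3
      · rw [← hgp]; exact hganti.antitone h2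
      · rw [hgg, hAF ⟨h2, h3⟩]
    rcases le_total x w with h4 | h4
    · rw [hfER ⟨h3, h4⟩, hER ⟨h3, h4⟩]
      exact hliftC _ ⟨hantiR.antitoneOn ⟨h3, h4⟩ ⟨hqw.le, le_rfl⟩ h4,
        (hantiR.antitoneOn ⟨le_rfl, hqw.le⟩ ⟨h3, h4⟩ h3).trans hqM⟩
    · rw [hfr ⟨h4, hx.2⟩]; exact hliftr x ⟨h4, hx.2⟩
  have hmaps : MapsTo f (Icc a b) (Icc a b) := fun x hx => by
    apply hsub
    rcases hlift x hx with ⟨h, -⟩ | ⟨h, -⟩ | ⟨h, -⟩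
    · exact ⟨h.1, by linarith [h.2]⟩
    · exact ⟨by linarith [h.1], by linarith [h.2]⟩
    · exact ⟨by linarith [h.1], h.2⟩
  have hff : ∀ x ∈ Icc a b, f (f x) = F x := fun x hx => by
    rcases hlift x hx with ⟨h, h'⟩ | ⟨h, h'⟩ | ⟨h, h'⟩
    · rw [hfEL h, h']
    · rw [hfg h, h']
    · rw [hfER h, h']
  have hflap : ∀ i ≤ v, InjOn f (Icc (c i) (c (i + 1))) := fun i hi x hx y hy hxy => by
    have hss : Icc (c i) (c (i + 1)) ⊆ Icc a b :=
      Icc_subset_Icc (hc.mem_Icc (by omega)).1 (hc.mem_Icc (by omega)).2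
    refine hc.injOn_lap hFc hi hx hy ?_
    rw [← hff x (hss hx), ← hff y (hss hy), hxy]
  -- As there are at least three forts, `w` is a fort when `k = 1`; otherwise `u` is one. Near `w`,
  -- `f` is at most `q = f w` on the left, and at least `q` on the right, where the first link uses
  -- the branch with values in `[q,w]`. At `u` the picture is mirrored, with `f u = p`.
  obtain ⟨d, hd, hdf⟩ : ∃ d ∈ forts a b F, IsMonotonePoint a b f d := by
    rcases hk.eq_or_lt with hk1 | hk1
    · refine ⟨w, hc.mem_forts (by omega) (by omega), ?_⟩
      have hfw : f w = q := (hfER ⟨hqw.le, le_rfl⟩).trans hERw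
      have hnr : 0 < nr := by
        by_contra! h
        have h1 := hr.start
        have h2 := hr.finish
        rw [Nat.le_zero.1 h] at h2
        omega
      have hr1 : k + 3 ≤ r 1 := by
        have : r 0 < r 1 := hr.mono 0 hnr
        have := hr.start
        omega
      refine isMonotonePoint_of_le_of_ge (u := q) (w := c (k + 3)) hfc
        (Icc_subset_Icc (by linarith) (hc.mem_Icc (by omega)).2)
        ⟨hqw, hc.lt (by omega) (by omega)⟩ (hflap (k + 1) (by omega)) (hflap (k + 2) (by omega))
        (fun x hx => ?_) (fun x hx => ?_)
      · rw [hfw, hfER hx, ← hERw]; exact ER.monotone hx.2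
      · have hx' : x ∈ Icc (c (r 0)) (c (r 1)) :=
          ⟨by rw [hr0]; exact hx.1, hx.2.trans (hc.le hr1 (hrle 1 hnr))⟩
        have hxm : m ≤ F x := (hr.min_eq 0 hnr (by simp)).2 (mem_image_of_mem F hx')
        rw [hfw, hfr ⟨hx.1, hx.2.trans (hc.mem_Icc (by omega)).2⟩, hfre 0 hnr x hx',
          chainBranch_zero _ _ _ (by simp)]
        exact (hSR _ ⟨hxm, (hrK 0 hnr x hx').2⟩).1
    · refine ⟨u, hc.mem_forts (by omega) (by omega), ?_⟩
      have hfu : f u = p := (hfEL ⟨le_rfl, hup.le⟩).trans hELu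
      have hnl : 0 < nl := by
        by_contra! h
        have h1 := hl.start
        have h2 := hl.finish
        rw [Nat.le_zero.1 h] at h2
        omega
      have hl1 : l 1 ≤ k - 2 := by
        have : l 1 < l 0 := hl.anti 0 hnl
        have := hl.start
        omega
      have hlap1 := hflap (k - 2) (by omega)
      have hlap2 := hflap (k - 1) (by omega)
      rw [show k - 2 + 1 = k - 1 by omega] at hlap1
      rw [show k - 1 + 1 = k by omega] at hlap2
      refine isMonotonePoint_of_le_of_ge (u := c (k - 2)) (w := p) hfc
        (Icc_subset_Icc (hc.mem_Icc (by omega)).1 (by linarith))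
        ⟨hc.lt (by omega) (by omega), hup⟩ hlap1 hlap2 (fun x hx => ?_) (fun x hx => ?_)
      · have hx' : x ∈ Icc (c (l 1)) (c (l 0)) :=
          ⟨(hc.le hl1 (by omega)).trans hx.1, by rw [hl0]; exact hx.2⟩
        have hxM : F x ≤ M := (hl.max_eq 0 hnl (by simp)).2 (mem_image_of_mem F hx')
        rw [hfu, hffl ⟨(hc.mem_Icc (by omega)).1.trans hx.1, hx.2⟩, hfle 0 hnl x hx',
          chainBranch_zero _ _ _ (by simp)]
        exact (hSL _ ⟨(hlK 0 hnl x hx').1, hxM⟩).2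
      · rw [hfu, hfEL hx, ← hELu]; exact EL.monotone hx.1
  obtain ⟨h1, h2⟩ := isPM_and_height_eq_two hF hfc hmaps hff hganti hFK hfg hd hdf
  exact ⟨f, h1, hff, h2, (hganti.strictAntiOn _).congr fun x hx => (hfg hx).symm⟩
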